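/- Let $k\in\mathbb N$, $T>0$, let $\Omega\subset\mathbb R^k$ be open, and let $g\in C^0(\mathbb R\times\Omega\times[0,1],\mathbb R^k)$ be $T$-periodic in its first variable. Write $g_0(v)=\int_0^T g(\tau,v,0)\,d\tau$ and $B_\delta(v_0)=\{v\in\mathbb R^k:\|v-v_0\|\le\delta\}$, and let $v_0\in\Omega$ be such that $g_0(v_0)=0$. Assume: (i) there is $L>0$ such that $\|g(t,v_1,\varepsilon)-g(t,v_2,\varepsilon)\|\le L\|v_1-v_2\|$ for all $t\in[0,T]$, $v_1,v_2\in\Omega$, $\varepsilon\in[0,1]$; (v) for every $\gamma>0$ there exist $\delta>0$ and a Lebesgue measurable set $M\subset[0,T]$ of Lebesgue measure less than $\gamma$ such that, for every $v\in B_\delta(v_0)$, $t\in[0,T]\setminus M$ and $\varepsilon\in[0,\delta]$, the map $g(t,\cdot,\varepsilon)$ is differentiable at $v$ and $\|g'_v(t,v,\varepsilon)-g'_v(t,v_0,0)\|\le\gamma$; (vi) $g_0$ is continuously differentiable in a neighborhood of $v_0$, and all (complex) eigenvalues of the Jacobian matrix $(g_0)'(v_0)$ have negative real part. Then there exist $\delta_1>0$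 and $\varepsilon_1\in(0,1]$ with $\varepsilon_1\le\delta_1$ such that for every $\varepsilon\in(0,\varepsilon_1]$ the system $$\dot x=\varepsilon\, g(t,x,\varepsilon)$$ has exactly one $T$-periodic solution $x_\varepsilon:\mathbb R\to\Omega$ with $x_\varepsilon(0)\in B_{\delta_1}(v_0)$. Moreover, the solution $x_\varepsilon$ is asymptotically stable (in the sense of Lyapunov), and $x_\varepsilon(0)\to v_0$ as $\varepsilon\to0^+$. -/

import Mathlib

open Set Filter Topology MeasureTheory

noncomputable section

/-- The space `ℝ^k` with its Euclidean norm. -/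
abbrev Vec (k : ℕ) : Type := EuclideanSpace ℝ (Fin k)

/-- The averaging function `g₀(v) = ∫₀ᵀ g(τ, v, 0) dτ`. -/
def averagingFunction {k : ℕ} (T : ℝ) (g : ℝ → Vec k → ℝ → Vec k) (v : Vec k) : Vec k :=
  ∫ τ in (0 : ℝ)..T, g τ v 0

/-- The Jacobian matrix of `h` at `v`: the entry `(i, j)` is `∂hᵢ/∂vⱼ (v)`. -/
def jacobianMatrix {k : ℕ} (h : Vec k → Vec k) (v : Vec k) : Matrix (Fin k) (Fin k) ℝ :=
  Matrix.of fun i j => (fderiv ℝ h v (EuclideanSpace.single j 1)) i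

/-- All (complex) eigenvalues of the real matrix `A` have negative real part. -/
def EigenvaluesNegRealPart {k : ℕ} (A : Matrix (Fin k) (Fin k) ℝ) : Prop :=
  ∀ μ : ℂ, Module.End.HasEigenvalue (Matrix.toLin' (A.map Complex.ofReal)) μ → μ.re < 0

/-- `x` solves `ẋ = f(t, x)` on the time interval `I`, with values in the domain `Ω`
(one-sided derivatives at end points of `I`). -/
def IsSolutionOn {k : ℕ} (f : ℝ → Vec k → Vec k) (Ω : Set (Vec k)) (I : Set ℝ)
    (x : ℝ → Vec k) : Prop :=
  ∀ t ∈ I, x t ∈ Ω ∧ HasDerivWithinAt x (f t (x t)) I t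

/-- `x` is a `T`-periodic solution (on all of `ℝ`) of `ẋ = f(t, x)` in `Ω`. -/
def IsPeriodicSolution {k : ℕ} (f : ℝ → Vec k → Vec k) (Ω : Set (Vec k)) (T : ℝ)
    (x : ℝ → Vec k) : Prop :=
  IsSolutionOn f Ω univ x ∧ Function.Periodic x T

/-- Asymptotic stability (in the sense of Lyapunov) of the solution `x` of `ẋ = f(t, x)`
in `Ω`: for every initial time `t₀`, solutions starting at time `t₀` close enough to `x t₀`
exist on `[t₀, ∞)` and stay as close to `x` as prescribed (stability), and solutions
starting close enough to `x t₀` converge to `x` as time tends to infinity (attractivity). -/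
def IsAsymptoticallyStable {k : ℕ} (f : ℝ → Vec k → Vec k) (Ω : Set (Vec k))
    (x : ℝ → Vec k) : Prop :=
  ∀ t₀ : ℝ,
    (∀ η > 0, ∃ δ > 0, ∀ y₀ : Vec k, ‖y₀ - x t₀‖ < δ →
      (∃ y : ℝ → Vec k, IsSolutionOn f Ω (Ici t₀) y ∧ y t₀ = y₀) ∧
      ∀ y : ℝ → Vec k, IsSolutionOn f Ω (Ici t₀) y → y t₀ = y₀ →
        ∀ t ≥ t₀, ‖y t - x t‖ < η) ∧
    (∃ δ > 0, ∀ y : ℝ → Vec k, IsSolutionOn f Ω (Ici t₀) y → ‖y t₀ - x t₀‖ < δ →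
      Tendsto (fun t => y t - x t) atTop (𝓝 0))

end

noncomputable section

/-! Everything is read off the time-`T` map `P` of `ẋ = ε g(t, x, ε)`, whose fixed points are the
initial values of periodic solutions. Let `A = g₀'(v₀)`. Near `v₀`, uniformly for small `ε`, `P u -
P v = (1 + ε A)(u - v)` up to an error `ε η ‖u - v‖` with `η` as small as desired
(`exists_return_map_linearization`). Differentiability of `g` is needed only off a time set of small
measure, because on that set the Lipschitz bound suffices after integration.

Since `A` is Hurwitz, there is a norm `q` in which `1 + s A` contracts with factor `1 - α s` for
small `s ≥ 0` (`exists_lyapunov_seminorm`). Taking `η` small enough to cost half this rate makes `P`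
a `q`-contraction with factor `κ = 1 - α ε / 2`.

Because `g₀(v₀) = 0`, the displacement `P v₀ - v₀` is `o(ε)` (`exists_return_map_displacement_le`),
whereas the contraction gap `1 - κ` is of order `ε`. Hence a small `q`-ball around `v₀` is mapped
into itself and contains a fixed point, which is unique in a fixed Euclidean ball and tends to `v₀`
as `ε → 0`. Geometric convergence of the iterates of `P`, together with Gronwall inside each period,
gives asymptotic stability. `HasContractingReturnMap` isolates what this last stage needs; in it the
field is truncated outside a ball so that solutions are global. -/

/-! ### Solutions, Gronwall estimates and global existence. -/

theorem IsSolutionOn.mono {k : ℕ} {f : ℝ → Vec k → Vec k} {Ω : Set (Vec k)} {I J : Set ℝ}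
    {x : ℝ → Vec k} (hx : IsSolutionOn f Ω I x) (hJ : J ⊆ I) : IsSolutionOn f Ω J x :=
  fun t ht => ⟨(hx t (hJ ht)).1, (hx t (hJ ht)).2.mono hJ⟩

theorem IsSolutionOn.continuousOn {k : ℕ} {f : ℝ → Vec k → Vec k} {Ω : Set (Vec k)} {I : Set ℝ}
    {x : ℝ → Vec k} (hx : IsSolutionOn f Ω I x) : ContinuousOn x I :=
  fun t ht => (hx t ht).2.continuousWithinAt

theorem IsSolutionOn.hasDerivWithinAt_Ici {k : ℕ} {f : ℝ → Vec k → Vec k} {Ω : Set (Vec k)}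
    {a b : ℝ} {x : ℝ → Vec k} (hx : IsSolutionOn f Ω (Icc a b) x) {t : ℝ} (ht : t ∈ Ico a b) :
    HasDerivWithinAt x (f t (x t)) (Ici t) t :=
  (hx t (Ico_subset_Icc_self ht)).2.mono_of_mem_nhdsWithin (Icc_mem_nhdsGE_of_mem ht)

theorem IsSolutionOn.congr_field {k : ℕ} {f f' : ℝ → Vec k → Vec k} {Ω Ω' : Set (Vec k)}
    {I : Set ℝ} {x : ℝ → Vec k} (hx : IsSolutionOn f Ω I x)
    (h : ∀ t ∈ I, x t ∈ Ω' ∧ f t (x t) = f' t (x t)) : IsSolutionOn f' Ω' I x :=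
  fun t ht => ⟨(h t ht).1, (h t ht).2 ▸ (hx t ht).2⟩

theorem IsSolutionOn.comp_add_const {k : ℕ} {f : ℝ → Vec k → Vec k} {Ω : Set (Vec k)}
    {I J : Set ℝ} {x : ℝ → Vec k} (hx : IsSolutionOn f Ω I x) (s : ℝ)
    (hJ : ∀ t ∈ J, t + s ∈ I) :
    IsSolutionOn (fun t => f (t + s)) Ω J (fun t => x (t + s)) := by
  intro t ht
  refine ⟨(hx _ (hJ t ht)).1, ?_⟩
  have h1 : HasDerivWithinAt (fun t : ℝ => t + s) 1 J t := (hasDerivWithinAt_id t J).add_const s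
  have h2 := (hx _ (hJ t ht)).2.scomp t h1 hJ
  rw [one_smul] at h2
  exact h2

/-- This is `e^y - 1 ≤ y e^y` with `y = K x`. Avoiding the quotient `ε / K` matters because both
constants later carry the small parameter as a factor. -/
theorem gronwallBound_le_mul_exp {δ K ε x : ℝ} (hK : 0 ≤ K) (hε : 0 ≤ ε) :
    gronwallBound δ K ε x ≤ (δ + ε * x) * Real.exp (K * x) := by
  rcases hK.eq_or_lt with rfl | hK
  · simp [gronwallBound_K0]
  · rw [gronwallBound_of_K_ne_0 hK.ne']
    have h1 : Real.exp (K * x) - 1 ≤ K * x * Real.exp (K * x) := by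
      have h2 := Real.add_one_le_exp (-(K * x))
      have h3 : Real.exp (-(K * x)) * Real.exp (K * x) = 1 := by
        rw [← Real.exp_add]; simp
      nlinarith [Real.exp_pos (K * x)]
    have h4 : ε / K * (Real.exp (K * x) - 1) ≤ ε / K * (K * x * Real.exp (K * x)) := by gcongr
    have h5 : ε / K * (K * x * Real.exp (K * x)) = ε * x * Real.exp (K * x) := by field_simp
    simp only
    linarith

theorem IsSolutionOn.norm_sub_le {k : ℕ} {f : ℝ → Vec k → Vec k} {Ω : Set (Vec k)} {a b K : ℝ}
    (hf : ∀ t, ∀ v₁ ∈ Ω, ∀ v₂ ∈ Ω, ‖f t v₁ - f t v₂‖ ≤ K * ‖v₁ - v₂‖) {u v : ℝ → Vec k}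
    (hu : IsSolutionOn f Ω (Icc a b) u) (hv : IsSolutionOn f Ω (Icc a b) v) {t : ℝ}
    (ht : t ∈ Icc a b) : ‖u t - v t‖ ≤ ‖u a - v a‖ * Real.exp (K * (t - a)) := by
  have := norm_le_gronwallBound_of_norm_deriv_right_le (f := fun t => u t - v t)
    (f' := fun t => f t (u t) - f t (v t)) (K := K) (ε := 0) (δ := ‖u a - v a‖)
    (hu.continuousOn.sub hv.continuousOn)
    (fun x hx => (hu.hasDerivWithinAt_Ici hx).sub (hv.hasDerivWithinAt_Ici hx)) le_rfl
    (fun x hx => by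
      simpa using hf x _ (hu x (Ico_subset_Icc_self hx)).1 _ (hv x (Ico_subset_Icc_self hx)).1)
    t ht
  simpa [gronwallBound_ε0] using this

theorem IsSolutionOn.norm_sub_const_le {k : ℕ} {f : ℝ → Vec k → Vec k} {Ω : Set (Vec k)}
    {a b K C : ℝ} (hK : 0 ≤ K) (hC : 0 ≤ C)
    (hf : ∀ t, ∀ v₁ ∈ Ω, ∀ v₂ ∈ Ω, ‖f t v₁ - f t v₂‖ ≤ K * ‖v₁ - v₂‖)
    {v₀ : Vec k} (hv₀ : v₀ ∈ Ω) (hfC : ∀ t, ‖f t v₀‖ ≤ C) {u : ℝ → Vec k}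
    (hu : IsSolutionOn f Ω (Icc a b) u) {t : ℝ} (ht : t ∈ Icc a b) :
    ‖u t - v₀‖ ≤ (‖u a - v₀‖ + C * (t - a)) * Real.exp (K * (t - a)) := by
  have := norm_le_gronwallBound_of_norm_deriv_right_le (f := fun t => u t - v₀)
    (f' := fun t => f t (u t)) (K := K) (ε := C) (δ := ‖u a - v₀‖)
    (hu.continuousOn.sub continuousOn_const)
    (fun x hx => (hu.hasDerivWithinAt_Ici hx).sub_const v₀) le_rfl
    (fun x hx => by
      have h1 := hf x _ (hu x (Ico_subset_Icc_self hx)).1 _ hv₀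
      have h2 := hfC x
      have h3 := norm_add_le (f x (u x) - f x v₀) (f x v₀)
      rw [sub_add_cancel] at h3
      linarith)
    t ht
  exact this.trans (gronwallBound_le_mul_exp hK hC)

theorem IsSolutionOn.norm_sub_initial_le {k : ℕ} {f : ℝ → Vec k → Vec k} {Ω : Set (Vec k)}
    {a b B : ℝ} {u : ℝ → Vec k} (hu : IsSolutionOn f Ω (Icc a b) u)
    (hB : ∀ t ∈ Icc a b, ‖f t (u t)‖ ≤ B) {t : ℝ} (ht : t ∈ Icc a b) :
    ‖u t - u a‖ ≤ B * (t - a) := by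
  have := (convex_Icc a b).norm_image_sub_le_of_norm_hasDerivWithin_le
    (fun t ht => (hu t ht).2) hB (left_mem_Icc.2 (ht.1.trans ht.2)) ht
  rwa [Real.norm_of_nonneg (sub_nonneg.2 ht.1)] at this

/-- A bounded vector field that is continuous in time and uniformly Lipschitz in space has
global solutions through every initial condition. -/
theorem exists_global_solution {k : ℕ} {F : ℝ → Vec k → Vec k} {K B : ℝ} (hK : 0 ≤ K)
    (hcont : ∀ v, Continuous fun t => F t v)
    (hlip : ∀ t v₁ v₂, ‖F t v₁ - F t v₂‖ ≤ K * ‖v₁ - v₂‖) (hB : ∀ t v, ‖F t v‖ ≤ B)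
    (t₀ : ℝ) (y₀ : Vec k) : ∃ y : ℝ → Vec k, IsSolutionOn F univ univ y ∧ y t₀ = y₀ := by
  have hB0 : 0 ≤ B := (norm_nonneg _).trans (hB t₀ y₀)
  have hloc : ∀ n : ℕ, ∃ y : ℝ → Vec k, y t₀ = y₀ ∧
      ∀ t ∈ Icc (t₀ - n) (t₀ + n), HasDerivWithinAt y (F t (y t)) (Icc (t₀ - n) (t₀ + n)) t := by
    intro n
    have hn : (0 : ℝ) ≤ n := n.cast_nonneg
    let t₀' : Icc (t₀ - n) (t₀ + n) := ⟨t₀, by constructor <;> linarith⟩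
    -- A solution moves at most `B n` in time `n`, so the ball of that radius admits the whole
    -- interval; no smallness of `n` is required.
    have hp : IsPicardLindelof F t₀' y₀ (B * n).toNNReal 0 B.toNNReal K.toNNReal := by
      refine ⟨fun t _ => ?_, fun x _ => (hcont x).continuousOn, fun t _ x _ => ?_, ?_⟩
      · refine LipschitzOnWith.of_dist_le_mul fun x _ y _ => ?_
        rw [dist_eq_norm, dist_eq_norm, Real.coe_toNNReal _ hK]
        exact hlip t x y
      · rw [Real.coe_toNNReal _ hB0]; exact hB t x
      · rw [Real.coe_toNNReal _ hB0, Real.coe_toNNReal _ (by positivity)]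
        simp [t₀']
    exact hp.exists_eq_forall_mem_Icc_hasDerivWithinAt₀
  choose Y hY0 hY using hloc
  have hsol : ∀ n : ℕ, IsSolutionOn F univ (Icc (t₀ - n) (t₀ + n)) (Y n) :=
    fun n t ht => ⟨mem_univ _, hY n t ht⟩
  have hagree : ∀ m n : ℕ, m ≤ n → EqOn (Y m) (Y n) (Ioo (t₀ - m) (t₀ + m)) := by
    intro m n hmn t ht
    have hmn' : (m : ℝ) ≤ n := by exact_mod_cast hmn
    have hs : Ioo (t₀ - m : ℝ) (t₀ + m) ⊆ Icc (t₀ - n) (t₀ + n) := fun s hs =>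
      ⟨by linarith [hs.1], by linarith [hs.2]⟩
    have ht₀ : t₀ ∈ Ioo (t₀ - m : ℝ) (t₀ + m) := by
      constructor <;> linarith [ht.1, ht.2]
    refine ODE_solution_unique_of_mem_Ioo (v := F) (K := K.toNNReal) (s := fun _ => univ)
      (fun t _ => ?_) ht₀ (fun s hs' => ⟨?_, mem_univ _⟩) (fun s hs' => ⟨?_, mem_univ _⟩)
      ((hY0 m).trans (hY0 n).symm) ht
    · refine LipschitzOnWith.of_dist_le_mul fun x _ y _ => ?_
      rw [dist_eq_norm, dist_eq_norm, Real.coe_toNNReal _ hK]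
      exact hlip t x y
    · exact (hY m s (Ioo_subset_Icc_self hs')).hasDerivAt (Icc_mem_nhds hs'.1 hs'.2)
    · exact (hY n s (hs hs')).hasDerivAt
        (Icc_mem_nhds (by linarith [hs'.1]) (by linarith [hs'.2]))
  -- The extra `1` puts `t` strictly inside its interval, where the local solutions agree and have
  -- two-sided derivatives.
  let N : ℝ → ℕ := fun t => ⌊|t - t₀|⌋₊ + 1
  have hN : ∀ t, |t - t₀| < N t := fun t => by
    simpa [N] using Nat.lt_floor_add_one |t - t₀|
  have hmem : ∀ (t : ℝ) (n : ℕ), |t - t₀| < n → t ∈ Ioo (t₀ - n : ℝ) (t₀ + n) := fun t n h => by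
    rw [abs_lt] at h
    constructor <;> linarith [h.1, h.2]
  have hval : ∀ (t : ℝ) (n : ℕ), |t - t₀| < n → Y (N t) t = Y n t := by
    intro t n h
    rcases le_total (N t) n with h' | h'
    · exact hagree _ _ h' (hmem t _ (hN t))
    · exact (hagree _ _ h' (hmem t _ h)).symm
  refine ⟨fun t => Y (N t) t, fun t _ => ⟨mem_univ _, ?_⟩, hY0 _⟩
  rw [hasDerivWithinAt_univ]
  have hnear : (fun s => Y (N s) s) =ᶠ[𝓝 t] Y (N t) := by
    have : ∀ᶠ s in 𝓝 t, |s - t₀| < N t :=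
      (continuous_abs.comp (continuous_id.sub continuous_const)).continuousAt.eventually_lt
        continuousAt_const (hN t)
    filter_upwards [this] with s hs using hval s _ hs
  refine HasDerivAt.congr_of_eventuallyEq ?_ hnear
  have h := hmem t _ (hN t)
  exact (hY _ t (Ioo_subset_Icc_self h)).hasDerivAt (Icc_mem_nhds h.1 h.2)

/-! ### Truncation to a ball. -/

/-- The radial retraction onto the closed ball of radius `R` around `v₀`. -/
def radialRetraction {k : ℕ} (v₀ : Vec k) (R : ℝ) (v : Vec k) : Vec k :=
  v₀ + (R / max R ‖v - v₀‖) • (v - v₀)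

theorem radialRetraction_mem {k : ℕ} (v₀ : Vec k) {R : ℝ} (hR : 0 < R) (v : Vec k) :
    radialRetraction v₀ R v ∈ Metric.closedBall v₀ R := by
  have hm : 0 < max R ‖v - v₀‖ := lt_max_of_lt_left hR
  rw [mem_closedBall_iff_norm, radialRetraction, add_sub_cancel_left, norm_smul,
    Real.norm_of_nonneg (by positivity), div_mul_eq_mul_div, div_le_iff₀ hm]
  gcongr
  exact le_max_right _ _

theorem radialRetraction_of_mem {k : ℕ} {v₀ : Vec k} {R : ℝ} (hR : 0 < R) {v : Vec k}
    (hv : v ∈ Metric.closedBall v₀ R) : radialRetraction v₀ R v = v := by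
  rw [mem_closedBall_iff_norm] at hv
  simp [radialRetraction, max_eq_left hv, hR.ne']

/-- The difference splits into a change of vector at fixed scaling and a change of scaling at fixed
vector, each costing at most `‖v - w‖`. The constant is not sharp, but any finite one serves for
global existence. -/
theorem norm_radialRetraction_sub_le {k : ℕ} (v₀ : Vec k) {R : ℝ} (hR : 0 < R) (v w : Vec k) :
    ‖radialRetraction v₀ R v - radialRetraction v₀ R w‖ ≤ 2 * ‖v - w‖ := by
  set a := v - v₀
  set b := w - v₀
  have hab : v - w = a - b := by simp [a, b]
  have h1 : 0 < max R ‖a‖ := lt_max_of_lt_left hR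
  have h2 : 0 < max R ‖b‖ := lt_max_of_lt_left hR
  have hsplit : radialRetraction v₀ R v - radialRetraction v₀ R w =
      (R / max R ‖a‖) • (a - b) + (R / max R ‖a‖ - R / max R ‖b‖) • b := by
    simp only [radialRetraction, a, b]; module
  have h3 : ‖(R / max R ‖a‖) • (a - b)‖ ≤ ‖a - b‖ := by
    rw [norm_smul, Real.norm_of_nonneg (by positivity)]
    exact mul_le_of_le_one_left (norm_nonneg _) ((div_le_one h1).2 (le_max_left _ _))
  have h4 : ‖(R / max R ‖a‖ - R / max R ‖b‖) • b‖ ≤ ‖a - b‖ := by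
    have h5 : R / max R ‖a‖ - R / max R ‖b‖ =
        (R / max R ‖a‖) * (max R ‖b‖ - max R ‖a‖) / max R ‖b‖ := by
      field_simp
    have h6 : |max R ‖b‖ - max R ‖a‖| ≤ ‖a - b‖ := by
      have h7 := abs_max_sub_max_le_abs ‖b‖ ‖a‖ R
      rw [max_comm R, max_comm R]
      exact h7.trans ((abs_norm_sub_norm_le b a).trans_eq (norm_sub_rev _ _))
    rw [norm_smul, h5, Real.norm_eq_abs, abs_div, abs_mul, abs_of_pos h2,
      abs_of_nonneg (show 0 ≤ R / max R ‖a‖ by positivity), div_mul_eq_mul_div, div_le_iff₀ h2]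
    have h8 : R / max R ‖a‖ ≤ 1 := (div_le_one h1).2 (le_max_left _ _)
    calc R / max R ‖a‖ * |max R ‖b‖ - max R ‖a‖| * ‖b‖ ≤ 1 * ‖a - b‖ * max R ‖b‖ := by
          gcongr
          exact le_max_right _ _
      _ = _ := by ring
  rw [hsplit, hab, two_mul]
  exact (norm_add_le _ _).trans (add_le_add h3 h4)

/-! ### Lyapunov norms for Hurwitz matrices. -/

-- For each eigenvalue, `|1 + h μ|² = 1 + h (2 Re μ + h |μ|²)`, which is below `1` for small `h >
-- 0`. The spectrum is finite, so one `h` serves for all eigenvalues; the spectral radius of `1 + h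
-- M` is then below `1`, and Gelfand's formula provides the power `n`.
open scoped Matrix.Norms.Operator in
theorem exists_norm_one_add_smul_pow_lt_one {k : ℕ} {M : Matrix (Fin k) (Fin k) ℂ}
    (hM : ∀ μ ∈ spectrum ℂ M, μ.re < 0) :
    ∃ h : ℝ, 0 < h ∧ ∃ n : ℕ, 0 < n ∧ ‖(1 + (h : ℂ) • M) ^ n‖ < 1 := by
  have hfin : (spectrum ℂ M).Finite := by
    rw [← Matrix.spectrum_toLin']
    exact Module.End.finite_spectrum _
  have hev : ∀ᶠ h : ℝ in 𝓝[>] 0, ∀ μ ∈ spectrum ℂ M, ‖1 + (h : ℂ) * μ‖ < 1 := by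
    rw [hfin.eventually_all]
    intro μ hμ
    have hre := hM μ hμ
    have hlim : Tendsto (fun h : ℝ => 2 * μ.re + h * Complex.normSq μ) (𝓝[>] 0)
        (𝓝 (2 * μ.re + 0 * Complex.normSq μ)) :=
      ((continuous_const.add (continuous_id.mul continuous_const)).tendsto 0).mono_left
        nhdsWithin_le_nhds
    filter_upwards [hlim.eventually_lt_const (u := 0) (by linarith), self_mem_nhdsWithin]
      with h hh hpos
    have hpos' : (0 : ℝ) < h := hpos
    have h1 : ‖1 + (h : ℂ) * μ‖ ^ 2 < 1 := by
      rw [← Complex.normSq_eq_norm_sq, Complex.normSq_apply]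
      rw [Complex.normSq_apply] at hh
      simp only [Complex.add_re, Complex.one_re, Complex.mul_re, Complex.ofReal_re,
        Complex.ofReal_im, Complex.add_im, Complex.one_im, Complex.mul_im]
      nlinarith
    exact (sq_lt_one_iff₀ (norm_nonneg _)).1 h1
  obtain ⟨h, hh, hpos⟩ := (hev.and self_mem_nhdsWithin).exists
  have hpos' : (0 : ℝ) < h := hpos
  have hne : (h : ℂ) ≠ 0 := by exact_mod_cast hpos'.ne'
  refine ⟨h, hpos', ?_⟩
  set B : Matrix (Fin k) (Fin k) ℂ := 1 + (h : ℂ) • M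
  have hspec : ∀ z ∈ spectrum ℂ B, ‖z‖ < 1 := by
    intro z hz
    have h1 : (z - 1) / h ∈ spectrum ℂ M := by
      rw [spectrum.mem_iff] at hz ⊢
      contrapose! hz
      have h2 : algebraMap ℂ _ z - B = (h : ℂ) • (algebraMap ℂ _ ((z - 1) / h) - M) := by
        simp only [B, Algebra.algebraMap_eq_smul_one, smul_sub, smul_smul]
        rw [mul_div_cancel₀ _ hne]
        module
      rw [h2]
      exact hz.smul (Units.mk0 _ hne)
    simpa [mul_div_cancel₀ _ hne] using hh _ h1
  have hrad : spectralRadius ℂ B < 1 := by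
    rcases (spectrum ℂ B).eq_empty_or_nonempty with he | hne'
    · simp [spectralRadius, he]
    · exact_mod_cast spectrum.spectralRadius_lt_of_forall_lt_of_nonempty hne' (r := 1)
        fun z hz => by exact_mod_cast hspec z hz
  obtain ⟨n, hn, hn0⟩ := ((spectrum.pow_nnnorm_pow_one_div_tendsto_nhds_spectralRadius B
    |>.eventually_lt_const hrad).and (eventually_gt_atTop 0)).exists
  refine ⟨n, hn0, ?_⟩
  by_contra! hcon
  refine hn.not_ge (ENNReal.one_le_rpow ?_ (by positivity))
  exact_mod_cast hcon

/-- Coordinatewise complexification. -/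
def complexify (k : ℕ) : Vec k →ₗ[ℝ] (Fin k → ℂ) where
  toFun v i := (v i : ℂ)
  map_add' v w := by ext; simp
  map_smul' a v := by ext; simp

theorem complexify_apply {k : ℕ} (v : Vec k) (i : Fin k) : complexify k v i = (v i : ℂ) := rfl

theorem mulVec_complexify {k : ℕ} (A : Vec k →L[ℝ] Vec k) (v : Vec k) :
    (((Matrix.of fun i j => A (EuclideanSpace.single j 1) i).map Complex.ofReal).mulVec
      (complexify k v)) = complexify k (A v) := by
  ext i
  have hv : v = ∑ j, v j • EuclideanSpace.single j (1 : ℝ) := by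
    ext l
    simp [Finset.sum_apply, Pi.single_apply]
  have hA : (A v) i = ∑ j, v j * (A (EuclideanSpace.single j 1)) i := by
    conv_lhs => rw [hv]
    simp [map_sum, Finset.sum_apply]
  simp only [Matrix.mulVec, dotProduct, Matrix.map_apply, Matrix.of_apply, complexify_apply, hA]
  push_cast
  exact Finset.sum_congr rfl fun j _ => mul_comm _ _

open scoped Matrix.Norms.Operator in
/-- A Lyapunov norm for a Hurwitz linear map `A`: the maps `1 + s A` with small `s ≥ 0`
contract it at a linear rate. -/
theorem exists_lyapunov_seminorm {k : ℕ} (A : Vec k →L[ℝ] Vec k)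
    (hA : EigenvaluesNegRealPart (Matrix.of fun i j => A (EuclideanSpace.single j 1) i)) :
    ∃ q : Seminorm ℝ (Vec k), ∃ c > 0, ∃ C > 0, ∃ α > 0, ∃ h > 0,
      (∀ v, c * ‖v‖ ≤ q v) ∧ (∀ v, q v ≤ C * ‖v‖) ∧
      ∀ s ∈ Icc (0 : ℝ) h, ∀ v, q (v + s • A v) ≤ (1 - α * s) * q v := by
  set M := (Matrix.of fun i j => A (EuclideanSpace.single j 1) i).map Complex.ofReal with hMdef
  have hM : ∀ μ ∈ spectrum ℂ M, μ.re < 0 := by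
    intro μ hμ
    rw [← Matrix.spectrum_toLin', ← Module.End.hasEigenvalue_iff_mem_spectrum] at hμ
    exact hA μ hμ
  obtain ⟨h, hh, n, hn, hBn⟩ := exists_norm_one_add_smul_pow_lt_one hM
  set B : Matrix (Fin k) (Fin k) ℂ := 1 + (h : ℂ) • M with hB
  -- The strict inequality `‖B ^ n‖ < 1` leaves room for a weight `w > 1`. The weighted sum of `‖B ^
  -- j v‖` over `j < n` then contracts under `B` in one step: multiplying by `w` and applying `B`
  -- shifts the index, and the new top term is at most the lost term `‖v‖`.
  obtain ⟨w, hw, hw1⟩ : ∃ w : ℝ, w ^ n * ‖B ^ n‖ < 1 ∧ 1 < w := by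
    have hlim : Tendsto (fun w : ℝ => w ^ n * ‖B ^ n‖) (𝓝[>] 1) (𝓝 (1 ^ n * ‖B ^ n‖)) :=
      (((continuous_pow n).mul continuous_const).tendsto 1).mono_left nhdsWithin_le_nhds
    exact ((hlim.eventually_lt_const (by simpa using hBn)).and self_mem_nhdsWithin).exists
  have hw0 : 0 < w := by linarith
  let q : Seminorm ℝ (Vec k) := Seminorm.of
    (fun v => ∑ j ∈ Finset.range n, w ^ j * ‖(B ^ j).mulVec (complexify k v)‖)
    (fun x y => by
      rw [← Finset.sum_add_distrib]
      refine Finset.sum_le_sum fun j _ => ?_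
      rw [map_add, Matrix.mulVec_add, ← mul_add]
      gcongr
      exact norm_add_le _ _)
    (fun a x => by
      rw [Finset.mul_sum]
      refine Finset.sum_congr rfl fun j _ => ?_
      rw [map_smul, Matrix.mulVec_smul, norm_smul]
      ring)
  have hq : ∀ v, q v = ∑ j ∈ Finset.range n, w ^ j * ‖(B ^ j).mulVec (complexify k v)‖ :=
    fun v => rfl
  have hstep : ∀ v, w * q (v + h • A v) ≤ q v := by
    intro v
    have h1 : complexify k (v + h • A v) = B.mulVec (complexify k v) := by
      rw [hB, Matrix.add_mulVec, Matrix.one_mulVec, Matrix.smul_mulVec, hMdef,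
        mulVec_complexify, map_add, map_smul]
      ext i
      simp
    have h2 : w * q (v + h • A v) =
        ∑ j ∈ Finset.range n, w ^ (j + 1) * ‖(B ^ (j + 1)).mulVec (complexify k v)‖ := by
      rw [hq, Finset.mul_sum]
      refine Finset.sum_congr rfl fun j _ => ?_
      rw [h1, Matrix.mulVec_mulVec, ← pow_succ]
      ring
    have h3 := (Finset.sum_range_succ
      (fun j => w ^ j * ‖(B ^ j).mulVec (complexify k v)‖) n).symm.trans
      (Finset.sum_range_succ' _ n)
    have h4 : w ^ n * ‖(B ^ n).mulVec (complexify k v)‖ ≤ ‖complexify k v‖ := by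
      calc _ ≤ w ^ n * (‖B ^ n‖ * ‖complexify k v‖) := by
            gcongr; exact Matrix.linfty_opNorm_mulVec _ _
        _ = w ^ n * ‖B ^ n‖ * ‖complexify k v‖ := by ring
        _ ≤ 1 * ‖complexify k v‖ := by gcongr
        _ = _ := one_mul _
    rw [← hq, ← h2] at h3
    simp only [pow_zero, Matrix.one_mulVec, one_mul] at h3
    linarith
  obtain ⟨κ, hκ, hanti⟩ := (complexify k).exists_antilipschitzWith (by
    rw [LinearMap.ker_eq_bot]
    intro v w hvw
    ext i
    exact Complex.ofReal_injective (congrFun hvw i))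
  let ι := LinearMap.toContinuousLinearMap (complexify k)
  have hι : ∀ v, ‖complexify k v‖ ≤ ‖ι‖ * ‖v‖ := fun v => ι.le_opNorm v
  have hlow : ∀ v, (κ : ℝ)⁻¹ * ‖v‖ ≤ q v := by
    intro v
    have h1 : ‖v‖ ≤ κ * ‖complexify k v‖ := by
      simpa using hanti.le_mul_dist v 0
    have h2 : ‖complexify k v‖ ≤ q v := by
      rw [hq]
      have := Finset.single_le_sum (f := fun j => w ^ j * ‖(B ^ j).mulVec (complexify k v)‖)
        (fun j _ => by positivity) (Finset.mem_range.2 hn)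
      simpa using this
    rw [inv_mul_le_iff₀ (by exact_mod_cast hκ)]
    exact h1.trans (by gcongr)
  refine ⟨q, (κ : ℝ)⁻¹, by positivity,
    (∑ j ∈ Finset.range n, w ^ j * (‖B ^ j‖ * ‖ι‖)) + 1, by positivity,
    (1 - w⁻¹) / h, div_pos (sub_pos.2 (inv_lt_one_of_one_lt₀ hw1)) hh, h, hh, hlow, ?_, ?_⟩
  · intro v
    calc q v ≤ ∑ j ∈ Finset.range n, w ^ j * (‖B ^ j‖ * ‖ι‖) * ‖v‖ := by
          rw [hq]
          refine Finset.sum_le_sum fun j _ => ?_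
          rw [mul_assoc, mul_assoc]
          gcongr
          exact (Matrix.linfty_opNorm_mulVec _ _).trans (by gcongr; exact hι v)
      _ = (∑ j ∈ Finset.range n, w ^ j * (‖B ^ j‖ * ‖ι‖)) * ‖v‖ := by rw [Finset.sum_mul]
      _ ≤ _ := by gcongr; linarith
  · intro s hs v
    -- The step of size `s` is a convex combination of the identity and the full step `h`, so the
    -- contraction at `h` interpolates linearly, with rate `(1 - w⁻¹) / h`.
    have h1 : v + s • A v = (1 - s / h) • v + (s / h) • (v + h • A v) := by
      rw [smul_add, smul_smul, div_mul_cancel₀ _ hh.ne']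
      module
    have h2 : 0 ≤ s / h := div_nonneg hs.1 hh.le
    have h3 : s / h ≤ 1 := (div_le_one hh).2 hs.2
    have h4 : q (v + h • A v) ≤ w⁻¹ * q v := by
      rw [le_inv_mul_iff₀ hw0]; exact hstep v
    calc q (v + s • A v) ≤ q ((1 - s / h) • v) + q ((s / h) • (v + h • A v)) := by
          rw [h1]; exact map_add_le_add q _ _
      _ = (1 - s / h) * q v + s / h * q (v + h • A v) := by
          rw [map_smul_eq_mul, map_smul_eq_mul, Real.norm_of_nonneg h2,
            Real.norm_of_nonneg (sub_nonneg.2 h3)]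
      _ ≤ (1 - s / h) * q v + s / h * (w⁻¹ * q v) := by gcongr
      _ = (1 - (1 - w⁻¹) / h * s) * q v := by ring

/-! ### Contracting return maps: periodic solutions, uniqueness and stability. -/

/-- A `T`-periodic vector field on `Ω`, Lipschitz in space and bounded by `B` on the ball of radius
`R` around `v₀`, whose time-`T` map contracts a norm `q` on the ball of radius `δ`. -/
structure HasContractingReturnMap {k : ℕ} (f : ℝ → Vec k → Vec k) (Ω : Set (Vec k))
    (v₀ : Vec k) (T δ R K B κ c C : ℝ) (q : Seminorm ℝ (Vec k)) : Prop where
  period_pos : 0 < T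
  δ_pos : 0 < δ
  R_pos : 0 < R
  K_nonneg : 0 ≤ K
  radius : δ + B * T ≤ R
  ball_subset : Metric.closedBall v₀ R ⊆ Ω
  periodic : ∀ t, ∀ v ∈ Ω, f (t + T) v = f t v
  cont : ∀ v ∈ Ω, Continuous fun t => f t v
  lip : ∀ t, ∀ v₁ ∈ Ω, ∀ v₂ ∈ Ω, ‖f t v₁ - f t v₂‖ ≤ K * ‖v₁ - v₂‖
  bound : ∀ t, ∀ v ∈ Metric.closedBall v₀ R, ‖f t v‖ ≤ B
  κ_nonneg : 0 ≤ κ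
  κ_lt_one : κ < 1
  c_pos : 0 < c
  le_q : ∀ v, c * ‖v‖ ≤ q v
  q_le : ∀ v, q v ≤ C * ‖v‖
  C_pos : 0 < C
  contract : ∀ u v, IsSolutionOn f Ω (Icc 0 T) u → IsSolutionOn f Ω (Icc 0 T) v →
    u 0 ∈ Metric.closedBall v₀ δ → v 0 ∈ Metric.closedBall v₀ δ →
    q (u T - v T) ≤ κ * q (u 0 - v 0)

/-- The vector field `f` composed with the retraction onto a ball. -/
def truncatedField {k : ℕ} (f : ℝ → Vec k → Vec k) (v₀ : Vec k) (R : ℝ) : ℝ → Vec k → Vec k :=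
  fun t v => f t (radialRetraction v₀ R v)

namespace HasContractingReturnMap

variable {k : ℕ} {f : ℝ → Vec k → Vec k} {Ω : Set (Vec k)} {v₀ : Vec k}
  {T δ R K B κ c C : ℝ} {q : Seminorm ℝ (Vec k)}

theorem B_nonneg (H : HasContractingReturnMap f Ω v₀ T δ R K B κ c C q) : 0 ≤ B :=
  (norm_nonneg _).trans (H.bound 0 v₀ (Metric.mem_closedBall_self H.R_pos.le))

theorem truncated_lip (H : HasContractingReturnMap f Ω v₀ T δ R K B κ c C q) (t : ℝ)
    (v₁ v₂ : Vec k) :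
    ‖truncatedField f v₀ R t v₁ - truncatedField f v₀ R t v₂‖ ≤ 2 * K * ‖v₁ - v₂‖ := by
  have h1 := H.lip t _ (H.ball_subset (radialRetraction_mem v₀ H.R_pos v₁)) _
    (H.ball_subset (radialRetraction_mem v₀ H.R_pos v₂))
  have h2 := mul_le_mul_of_nonneg_left (norm_radialRetraction_sub_le v₀ H.R_pos v₁ v₂) H.K_nonneg
  exact (h1.trans h2).trans_eq (by ring)

theorem truncated_bound (H : HasContractingReturnMap f Ω v₀ T δ R K B κ c C q) (t : ℝ)
    (v : Vec k) : ‖truncatedField f v₀ R t v‖ ≤ B :=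
  H.bound t _ (radialRetraction_mem v₀ H.R_pos v)

theorem exists_truncated_solution (H : HasContractingReturnMap f Ω v₀ T δ R K B κ c C q)
    (t₀ : ℝ) (y₀ : Vec k) :
    ∃ y, IsSolutionOn (truncatedField f v₀ R) univ univ y ∧ y t₀ = y₀ :=
  exists_global_solution (mul_nonneg zero_le_two H.K_nonneg)
    (fun v => H.cont _ (H.ball_subset (radialRetraction_mem v₀ H.R_pos v)))
    H.truncated_lip H.truncated_bound t₀ y₀

theorem truncated_norm_sub_le (H : HasContractingReturnMap f Ω v₀ T δ R K B κ c C q)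
    {x y : ℝ → Vec k} (hx : IsSolutionOn (truncatedField f v₀ R) univ univ x)
    (hy : IsSolutionOn (truncatedField f v₀ R) univ univ y) {a t : ℝ} (hat : a ≤ t)
    (htT : t ≤ a + T) : ‖y t - x t‖ ≤ Real.exp (2 * K * T) * ‖y a - x a‖ := by
  have h1 := (hy.mono (subset_univ (Icc a t))).norm_sub_le
    (fun t v₁ _ v₂ _ => H.truncated_lip t v₁ v₂) (hx.mono (subset_univ _)) (right_mem_Icc.2 hat)
  have hK := H.K_nonneg
  calc _ ≤ _ := h1
    _ ≤ ‖y a - x a‖ * Real.exp (2 * K * T) := by gcongr; linarith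
    _ = _ := mul_comm _ _

theorem truncated_eq (H : HasContractingReturnMap f Ω v₀ T δ R K B κ c C q)
    {x y : ℝ → Vec k} (hx : IsSolutionOn (truncatedField f v₀ R) univ univ x)
    (hy : IsSolutionOn (truncatedField f v₀ R) univ univ y) {a : ℝ} (h : y a = x a) : y = x := by
  refine ODE_solution_unique_univ (v := truncatedField f v₀ R) (K := (2 * K).toNNReal)
    (s := fun _ => univ) (t₀ := a) (fun t => ?_)
    (fun t => ⟨hasDerivWithinAt_univ.1 (hy t trivial).2, trivial⟩)
    (fun t => ⟨hasDerivWithinAt_univ.1 (hx t trivial).2, trivial⟩) h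
  refine LipschitzOnWith.of_dist_le_mul fun v _ w _ => ?_
  rw [dist_eq_norm, dist_eq_norm, Real.coe_toNNReal _ (mul_nonneg zero_le_two H.K_nonneg)]
  exact H.truncated_lip t v w

theorem truncated_norm_sub_center_le (H : HasContractingReturnMap f Ω v₀ T δ R K B κ c C q)
    {y : ℝ → Vec k} (hy : IsSolutionOn (truncatedField f v₀ R) univ univ y) {a t : ℝ}
    (hat : a ≤ t) (htT : t ≤ a + T) : ‖y t - v₀‖ ≤ ‖y a - v₀‖ + B * T := by
  have h1 := (hy.mono (subset_univ (Icc a t))).norm_sub_initial_le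
    (fun t _ => H.truncated_bound t _) (right_mem_Icc.2 hat)
  have h2 : B * (t - a) ≤ B * T :=
    mul_le_mul_of_nonneg_left (by linarith) H.B_nonneg
  have h3 := norm_add_le (y t - y a) (y a - v₀)
  rw [sub_add_sub_cancel] at h3
  linarith

/-- The speed is at most `B`, so one period moves a point by at most `B T ≤ R - δ`. Truncation is
therefore invisible over a period started in the `δ`-ball. -/
theorem truncated_stays (H : HasContractingReturnMap f Ω v₀ T δ R K B κ c C q)
    {y : ℝ → Vec k} (hy : IsSolutionOn (truncatedField f v₀ R) univ univ y) {a t : ℝ}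
    (ha : y a ∈ Metric.closedBall v₀ δ) (hat : a ≤ t) (htT : t ≤ a + T) :
    y t ∈ Metric.closedBall v₀ R := by
  rw [mem_closedBall_iff_norm] at ha ⊢
  linarith [H.truncated_norm_sub_center_le hy hat htT, H.radius]

theorem isSolutionOn_of_truncated (H : HasContractingReturnMap f Ω v₀ T δ R K B κ c C q)
    {y : ℝ → Vec k} (hy : IsSolutionOn (truncatedField f v₀ R) univ univ y) {I : Set ℝ}
    (hI : ∀ t ∈ I, y t ∈ Metric.closedBall v₀ R) : IsSolutionOn f Ω I y :=
  (hy.mono (subset_univ I)).congr_field fun t ht =>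
    ⟨H.ball_subset (hI t ht), by
      rw [truncatedField, radialRetraction_of_mem H.R_pos (hI t ht)]⟩

theorem field_add_int_mul (H : HasContractingReturnMap f Ω v₀ T δ R K B κ c C q) (n : ℤ) (t : ℝ)
    {v : Vec k} (hv : v ∈ Ω) : f (t + n * T) v = f t v :=
  (Function.Periodic.int_mul (f := fun t => f t v) (fun t => H.periodic t v hv) n) t

/-- The contraction estimate over any period starting at an integer multiple of `T`. -/
theorem truncated_contract (H : HasContractingReturnMap f Ω v₀ T δ R K B κ c C q)
    {x y : ℝ → Vec k} (hx : IsSolutionOn (truncatedField f v₀ R) univ univ x)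
    (hy : IsSolutionOn (truncatedField f v₀ R) univ univ y) (n : ℤ)
    (hxn : x (n * T) ∈ Metric.closedBall v₀ δ) (hyn : y (n * T) ∈ Metric.closedBall v₀ δ) :
    q (y (n * T + T) - x (n * T + T)) ≤ κ * q (y (n * T) - x (n * T)) := by
  have key : ∀ z : ℝ → Vec k, IsSolutionOn (truncatedField f v₀ R) univ univ z →
      z (n * T) ∈ Metric.closedBall v₀ δ →
      IsSolutionOn f Ω (Icc 0 T) (fun t => z (t + n * T)) := by
    intro z hz hzn
    have h1 : IsSolutionOn f Ω (Icc (n * T) (n * T + T)) z :=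
      H.isSolutionOn_of_truncated hz fun t ht => H.truncated_stays hz hzn ht.1 ht.2
    have h2 := h1.comp_add_const (J := Icc 0 T) (n * T)
      (fun t ht => ⟨by linarith [ht.1], by linarith [ht.2]⟩)
    exact h2.congr_field fun t ht => ⟨(h2 t ht).1, H.field_add_int_mul n t (h2 t ht).1⟩
  have := H.contract _ _ (key y hy hyn) (key x hx hxn) (by simpa using hyn) (by simpa using hxn)
  simpa [add_comm] using this

theorem eq_zero_of_q_le (H : HasContractingReturnMap f Ω v₀ T δ R K B κ c C q) {v : Vec k}
    (h : q v ≤ κ * q v) : v = 0 := by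
  have h1 := H.le_q v
  have h2 : q v ≤ 0 := by nlinarith [H.κ_lt_one]
  have h3 : ‖v‖ ≤ 0 := by
    by_contra! h4
    nlinarith [mul_pos H.c_pos h4]
  exact norm_le_zero_iff.1 h3

/-- A displacement of `v₀` by at most `(1 - κ) r` makes the return map preserve the `q`-ball of
radius `r`. A fixed point gives a periodic solution, since the solution and its shift by `T` then
agree at time `0`. -/
theorem exists_periodic_truncated (H : HasContractingReturnMap f Ω v₀ T δ R K B κ c C q) {r : ℝ}
    (hr : 0 ≤ r) (hrδ : ∀ v, q (v - v₀) ≤ r → v ∈ Metric.closedBall v₀ δ)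
    (hret : ∀ u, IsSolutionOn f Ω (Icc 0 T) u → u 0 = v₀ → q (u T - v₀) ≤ (1 - κ) * r) :
    ∃ x, IsSolutionOn (truncatedField f v₀ R) univ univ x ∧ Function.Periodic x T ∧
      q (x 0 - v₀) ≤ r := by
  choose Φ hΦ hΦ0 using H.exists_truncated_solution 0
  have hcontr : ∀ v w, v ∈ Metric.closedBall v₀ δ → w ∈ Metric.closedBall v₀ δ →
      q (Φ v T - Φ w T) ≤ κ * q (v - w) := by
    intro v w hv hw
    have := H.truncated_contract (hΦ w) (hΦ v) 0 (by simpa [hΦ0]) (by simpa [hΦ0])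
    simpa [hΦ0] using this
  have hself : v₀ ∈ Metric.closedBall v₀ δ := Metric.mem_closedBall_self H.δ_pos.le
  have hv₀ : q (Φ v₀ T - v₀) ≤ (1 - κ) * r :=
    hret _ (H.isSolutionOn_of_truncated (hΦ v₀) fun t ht =>
      H.truncated_stays (hΦ v₀) (by rwa [hΦ0]) ht.1 (by linarith [ht.2])) (hΦ0 v₀)
  let S : Set (Vec k) := {v | q (v - v₀) ≤ r}
  have hqc : Continuous q := by
    have h1 : LipschitzWith C.toNNReal q := LipschitzWith.of_dist_le_mul fun v w => by
      rw [Real.dist_eq, dist_eq_norm, Real.coe_toNNReal _ H.C_pos.le]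
      exact (abs_sub_map_le_sub q v w).trans (H.q_le _)
    exact h1.continuous
  have hSc : IsCompact S := by
    refine Metric.isCompact_of_isClosed_isBounded ?_
      (Metric.isBounded_closedBall.subset fun v hv => hrδ v hv)
    exact isClosed_le (hqc.comp (continuous_id.sub continuous_const)) continuous_const
  have hmap : ∀ v ∈ S, Φ v T ∈ S := by
    intro v hv
    have h1 := hcontr v v₀ (hrδ v hv) hself
    have h2 := map_add_le_add q (Φ v T - Φ v₀ T) (Φ v₀ T - v₀)
    rw [sub_add_sub_cancel] at h2
    have h3 : κ * q (v - v₀) ≤ κ * r := mul_le_mul_of_nonneg_left hv H.κ_nonneg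
    change q _ ≤ r
    linarith
  have hPc : ContinuousOn (fun v => Φ v T) S := by
    refine Continuous.continuousOn ?_
    have h1 : LipschitzWith (Real.exp (2 * K * T)).toNNReal (fun v => Φ v T) :=
      LipschitzWith.of_dist_le_mul fun v w => by
        rw [dist_eq_norm, dist_eq_norm, Real.coe_toNNReal _ (Real.exp_pos _).le]
        have := H.truncated_norm_sub_le (hΦ w) (hΦ v) H.period_pos.le (by simp)
        simpa [hΦ0] using this
    exact h1.continuous
  -- Minimise `q (P v - v)` over the compact `q`-ball. At a minimiser `p`, comparison with `P p` and
  -- contraction give `q (P p - p) ≤ κ q (P p - p)`, so `p` is fixed; this avoids re-metrising the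
  -- space by `q`.
  obtain ⟨p, hpS, hp⟩ := hSc.exists_isMinOn ⟨v₀, by simpa [S] using hr⟩
    (hqc.comp_continuousOn (hPc.sub continuousOn_id))
  have hfix : Φ p T = p := by
    have h1 : q (Φ p T - p) ≤ q (Φ (Φ p T) T - Φ p T) := hp (hmap p hpS)
    have h2 := hcontr _ _ (hrδ _ (hmap p hpS)) (hrδ p hpS)
    exact sub_eq_zero.1 (H.eq_zero_of_q_le (h1.trans h2))
  refine ⟨Φ p, hΦ p, ?_, by rw [hΦ0]; exact hpS⟩
  have hshift : IsSolutionOn (truncatedField f v₀ R) univ univ (fun t => Φ p (t + T)) := by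
    have h2 := (hΦ p).comp_add_const (J := univ) T fun _ _ => trivial
    exact h2.congr_field fun t ht => ⟨trivial, H.periodic t _
      (H.ball_subset (radialRetraction_mem v₀ H.R_pos _))⟩
  exact congrFun (H.truncated_eq (hΦ p) hshift (a := 0) (by simp [hfix, hΦ0]))

theorem periodic_truncated_norm_le (H : HasContractingReturnMap f Ω v₀ T δ R K B κ c C q)
    {x : ℝ → Vec k} (hx : IsSolutionOn (truncatedField f v₀ R) univ univ x)
    (hper : Function.Periodic x T) (t : ℝ) : ‖x t - v₀‖ ≤ ‖x 0 - v₀‖ + B * T := by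
  obtain ⟨s, hs, hst⟩ := hper.exists_mem_Ico₀ H.period_pos t
  rw [hst]
  exact H.truncated_norm_sub_center_le hx hs.1 (by linarith [hs.2])

theorem periodic_truncated_mem (H : HasContractingReturnMap f Ω v₀ T δ R K B κ c C q)
    {x : ℝ → Vec k} (hx : IsSolutionOn (truncatedField f v₀ R) univ univ x)
    (hper : Function.Periodic x T) (h0 : x 0 ∈ Metric.closedBall v₀ δ) (t : ℝ) :
    x t ∈ Metric.closedBall v₀ R := by
  have h1 := H.periodic_truncated_norm_le hx hper t
  rw [mem_closedBall_iff_norm] at h0 ⊢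
  linarith [H.radius]

/-- Both initial values are fixed by the contracting return map, hence equal; Gronwall on `[0, T]`
and periodicity do the rest. -/
theorem periodic_unique (H : HasContractingReturnMap f Ω v₀ T δ R K B κ c C q)
    {x y : ℝ → Vec k} (hx : IsPeriodicSolution f Ω T x) (hy : IsPeriodicSolution f Ω T y)
    (hx0 : x 0 ∈ Metric.closedBall v₀ δ) (hy0 : y 0 ∈ Metric.closedBall v₀ δ) : y = x := by
  have h1 := H.contract y x (hy.1.mono (subset_univ _)) (hx.1.mono (subset_univ _)) hy0 hx0
  have hy2 := hy.2 0
  have hx2 := hx.2 0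
  rw [zero_add] at hy2 hx2
  rw [hy2, hx2] at h1
  have h0 := H.eq_zero_of_q_le h1
  funext t
  obtain ⟨s, hs, hst⟩ := (hy.2.sub hx.2).exists_mem_Ico₀ H.period_pos t
  have h2 := (hy.1.mono (subset_univ (Icc 0 T))).norm_sub_le H.lip (hx.1.mono (subset_univ _))
    (Ico_subset_Icc_self hs)
  rw [h0, norm_zero, zero_mul] at h2
  exact sub_eq_zero.1 (hst.trans (norm_le_zero_iff.1 h2))

/-- Solutions of the truncated field starting near a periodic solution stay near it and approach
it geometrically. -/
theorem truncated_decay (H : HasContractingReturnMap f Ω v₀ T δ R K B κ c C q)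
    {x : ℝ → Vec k} (hx : IsSolutionOn (truncatedField f v₀ R) univ univ x)
    (hper : Function.Periodic x T) {Q : ℝ}
    (hQ : Q = Real.exp (2 * K * T) * (1 + C / c * Real.exp (2 * K * T)))
    {y : ℝ → Vec k} (hy : IsSolutionOn (truncatedField f v₀ R) univ univ y) {t₀ d : ℝ}
    (hd : ‖y t₀ - x t₀‖ ≤ d) (hdδ : Q * d ≤ δ - ‖x 0 - v₀‖) :
    ∃ s₀ ≥ t₀, (∀ t ∈ Icc t₀ s₀, ‖y t - x t‖ ≤ Q * d) ∧
      ∀ m : ℕ, ∀ t ≥ s₀ + m * T, ‖y t - x t‖ ≤ Q * d * κ ^ m := by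
  have hT := H.period_pos
  have hc := H.c_pos
  have hC := H.C_pos
  have hκ := H.κ_nonneg
  have hd0 : 0 ≤ d := (norm_nonneg _).trans hd
  -- In `Q`, one factor `E` bounds growth up to the first multiple of `T`, `C / c` pays for passing
  -- to `q` and back, and another `E` bounds growth inside the last period. The assumption on `Q *
  -- d` keeps the iterates in the `δ`-ball, where contraction is available.
  set E := Real.exp (2 * K * T) with hE
  have hE1 : 1 ≤ E := Real.one_le_exp (by have := H.K_nonneg; positivity)
  have hEQ : E ≤ Q := by
    rw [hQ]
    exact le_mul_of_one_le_right (by positivity) (le_add_of_nonneg_right (by positivity))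
  have hCEQ : C / c * E ≤ Q := by
    rw [hQ]
    have : 0 ≤ C / c * E := by positivity
    nlinarith
  have hECEQ : E * (C / c * E) ≤ Q := by
    rw [hQ]
    gcongr
    linarith
  -- Contraction is known only over periods starting at multiples of `T`, so the count begins at the
  -- first one after `t₀`.
  set n : ℤ := ⌈t₀ / T⌉ with hn
  have hn1 : t₀ ≤ n * T := (div_le_iff₀ hT).1 (Int.le_ceil _)
  have hn2 : (n : ℝ) * T ≤ t₀ + T := by
    have := (Int.ceil_lt_add_one (t₀ / T)).le
    have := mul_le_mul_of_nonneg_right this hT.le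
    rwa [add_mul, div_mul_cancel₀ _ hT.ne', one_mul] at this
  have hxn : ∀ j : ℤ, x (j * T) = x 0 := fun j => by
    simpa using hper.int_mul j 0
  have hstart : ∀ t ∈ Icc t₀ (n * T), ‖y t - x t‖ ≤ E * d := fun t ht =>
    (H.truncated_norm_sub_le hx hy ht.1 (ht.2.trans hn2)).trans (by gcongr)
  have hball : ∀ v : Vec k, ‖v - x 0‖ ≤ Q * d → v ∈ Metric.closedBall v₀ δ := fun v hv => by
    rw [mem_closedBall_iff_norm]
    have := norm_add_le (v - x 0) (x 0 - v₀)
    rw [sub_add_sub_cancel] at this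
    linarith
  have hball_of_q : ∀ (m : ℕ) (v : Vec k), q (v - x 0) ≤ κ ^ m * (C * (E * d)) →
      ‖v - x 0‖ ≤ C / c * E * d * κ ^ m := fun m v hv => by
    have h1 := (H.le_q _).trans hv
    rw [mul_comm, ← le_div_iff₀ hc] at h1
    exact h1.trans_eq (by ring)
  have hsmall : ∀ m : ℕ, C / c * E * d * κ ^ m ≤ Q * d := fun m => by
    have h1 : κ ^ m ≤ 1 := pow_le_one₀ hκ H.κ_lt_one.le
    calc C / c * E * d * κ ^ m ≤ C / c * E * d * 1 := by gcongr
      _ ≤ Q * d := by rw [mul_one]; gcongr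
  have hx0 : x 0 ∈ Metric.closedBall v₀ δ := hball _ (by
    rw [sub_self, norm_zero]; exact mul_nonneg (by linarith) hd0)
  have hiter : ∀ m : ℕ, q (y ((n + m : ℤ) * T) - x 0) ≤ κ ^ m * (C * (E * d)) := by
    intro m
    induction m with
    | zero =>
      have h1 := hstart (n * T) ⟨hn1, le_rfl⟩
      rw [hxn] at h1
      simpa using (H.q_le _).trans (mul_le_mul_of_nonneg_left h1 hC.le)
    | succ m ih =>
      have h1 := H.truncated_contract hx hy (n + m) (by rwa [hxn])
        (hball _ ((hball_of_q m _ ih).trans (hsmall m)))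
      have h2 : (((n + m : ℤ) : ℝ)) * T + T = ((n + (m + 1 : ℕ) : ℤ) : ℝ) * T := by
        push_cast; ring
      rw [h2, hxn, hxn] at h1
      calc _ ≤ _ := h1
        _ ≤ κ * (κ ^ m * (C * (E * d))) := by gcongr
        _ = _ := by ring
  refine ⟨n * T, hn1, fun t ht => (hstart t ht).trans (by gcongr), fun m t ht => ?_⟩
  set j : ℕ := ⌊(t - n * T) / T⌋₊ with hj
  have hmT : (m : ℝ) ≤ (t - n * T) / T := by
    rw [le_div_iff₀ hT]; linarith
  have hmj : m ≤ j := Nat.le_floor hmT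
  have h1 : ((n + j : ℤ) : ℝ) * T ≤ t := by
    have := Nat.floor_le ((Nat.cast_nonneg m).trans hmT)
    rw [le_div_iff₀ hT] at this
    push_cast
    linarith
  have h2 : t ≤ ((n + j : ℤ) : ℝ) * T + T := by
    have := (Nat.lt_floor_add_one ((t - n * T) / T)).le
    rw [div_le_iff₀ hT] at this
    push_cast
    linarith
  have h3 := H.truncated_norm_sub_le hx hy h1 h2
  rw [hxn] at h3
  have h4 := hball_of_q j _ (hiter j)
  calc ‖y t - x t‖ ≤ E * (C / c * E * d * κ ^ j) := h3.trans (by gcongr)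
    _ = E * (C / c * E) * d * κ ^ j := by ring
    _ ≤ Q * d * κ ^ m := by
      have hQd : 0 ≤ Q * d := by rw [hQ]; positivity
      have : κ ^ j ≤ κ ^ m := pow_le_pow_of_le_one hκ H.κ_lt_one.le hmj
      gcongr

theorem isAsymptoticallyStable (H : HasContractingReturnMap f Ω v₀ T δ R K B κ c C q)
    {x : ℝ → Vec k} (hx : IsSolutionOn (truncatedField f v₀ R) univ univ x)
    (hper : Function.Periodic x T) (h0 : x 0 ∈ Metric.ball v₀ δ) :
    IsAsymptoticallyStable f Ω x := by
  intro t₀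
  have hT := H.period_pos
  have hc := H.c_pos
  have hC := H.C_pos
  obtain ⟨Q, hQ⟩ : ∃ Q, Q = Real.exp (2 * K * T) * (1 + C / c * Real.exp (2 * K * T)) := ⟨_, rfl⟩
  have hQ0 : 0 < Q := by rw [hQ]; positivity
  set σ := δ - ‖x 0 - v₀‖ with hσ
  have hσ0 : 0 < σ := by rw [mem_ball_iff_norm] at h0; linarith
  have hdecay : ∀ d, Q * d ≤ σ → ∀ y₀ : Vec k, ‖y₀ - x t₀‖ ≤ d →
      ∃ y, IsSolutionOn f Ω (Ici t₀) y ∧ y t₀ = y₀ ∧ (∀ t ≥ t₀, ‖y t - x t‖ ≤ Q * d) ∧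
        Tendsto (fun t => y t - x t) atTop (𝓝 0) := by
    intro d hd y₀ hy₀
    obtain ⟨y, hy, hyt⟩ := H.exists_truncated_solution t₀ y₀
    obtain ⟨s₀, hs₀, hshort, hlong⟩ := H.truncated_decay hx hper hQ hy (hyt ▸ hy₀) hd
    have hclose : ∀ t ≥ t₀, ‖y t - x t‖ ≤ Q * d := by
      intro t ht
      rcases le_total t s₀ with h | h
      · exact hshort t ⟨ht, h⟩
      · simpa using hlong 0 t (by simpa using h)
    refine ⟨y, H.isSolutionOn_of_truncated hy fun t ht => ?_, hyt, hclose, ?_⟩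
    · rw [mem_closedBall_iff_norm]
      have h1 := norm_add_le (y t - x t) (x t - v₀)
      rw [sub_add_sub_cancel] at h1
      linarith [hclose t ht, H.periodic_truncated_norm_le hx hper t, H.radius]
    · rw [tendsto_zero_iff_norm_tendsto_zero, Metric.tendsto_atTop]
      intro η hη
      have hlim : Tendsto (fun m : ℕ => Q * d * κ ^ m) atTop (𝓝 (Q * d * 0)) :=
        (tendsto_pow_atTop_nhds_zero_of_lt_one H.κ_nonneg H.κ_lt_one).const_mul _
      rw [mul_zero] at hlim
      obtain ⟨m, hm⟩ := (hlim.eventually_lt_const hη).exists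
      refine ⟨s₀ + m * T, fun t ht => ?_⟩
      rw [Real.dist_eq, sub_zero, abs_norm]
      exact (hlong m t ht).trans_lt hm
  -- Stability concerns every solution of the original field in `Ω`; the Lipschitz bound on `Ω`
  -- identifies it with the truncated solution just constructed.
  have huniq : ∀ y z, IsSolutionOn f Ω (Ici t₀) y → IsSolutionOn f Ω (Ici t₀) z →
      y t₀ = z t₀ → ∀ t ≥ t₀, y t = z t := by
    intro y z hy hz hyz t ht
    have := (hy.mono (J := Icc t₀ t) Icc_subset_Ici_self).norm_sub_le H.lip
      (hz.mono Icc_subset_Ici_self) (right_mem_Icc.2 ht)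
    rw [hyz, sub_self, norm_zero, zero_mul] at this
    exact sub_eq_zero.1 (norm_le_zero_iff.1 this)
  refine ⟨fun η hη => ?_, σ / Q, by positivity, fun y hy hyd => ?_⟩
  · have hm : 0 < min σ (η / 2) := by positivity
    have hQd : Q * (min σ (η / 2) / Q) = min σ (η / 2) := by field_simp
    refine ⟨min σ (η / 2) / Q, by positivity, fun y₀ hy₀ => ?_⟩
    obtain ⟨y, hy, hyt, hclose, -⟩ := hdecay _ (hQd.trans_le (min_le_left _ _)) y₀ hy₀.le
    refine ⟨⟨y, hy, hyt⟩, fun z hz hzt t ht => ?_⟩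
    rw [huniq z y hz hy (hzt.trans hyt.symm) t ht]
    have := hclose t ht
    rw [hQd] at this
    linarith [min_le_right σ (η / 2)]
  · obtain ⟨z, hz, hzt, -, hlim⟩ := hdecay (σ / Q) (by field_simp; rfl) _ hyd.le
    refine hlim.congr' ?_
    filter_upwards [eventually_ge_atTop t₀] with t ht
    rw [huniq z y hz hy hzt t ht]

end HasContractingReturnMap

/-! ### Integral estimates and the return map for small `ε`. -/

/-- Replacing `M` by its measurable hull gives an integrable majorant, `K₁` plus `K₂` times an
indicator, so neither measurability of `M` nor integrability of `f` is assumed. -/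
theorem norm_intervalIntegral_le_of_small_set {E : Type*} [NormedAddCommGroup E] [NormedSpace ℝ E]
    {f : ℝ → E} {T K₁ K₂ γ : ℝ} {M : Set ℝ} (hT : 0 ≤ T) (hK₁ : 0 ≤ K₁) (hK₂ : 0 ≤ K₂)
    (hγ : 0 ≤ γ) (hM : volume M ≤ ENNReal.ofReal γ) (h₁ : ∀ t ∈ Icc 0 T \ M, ‖f t‖ ≤ K₁)
    (h₂ : ∀ t ∈ Icc 0 T, ‖f t‖ ≤ K₂) : ‖∫ t in (0 : ℝ)..T, f t‖ ≤ T * K₁ + γ * K₂ := by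
  set M' := toMeasurable volume M
  have hM' : MeasurableSet M' := measurableSet_toMeasurable _ _
  have hvol : volume M' ≤ ENNReal.ofReal γ := (measure_toMeasurable M).trans_le hM
  have hint : IntervalIntegrable (M'.indicator fun _ => K₂) volume 0 T := by
    rw [intervalIntegrable_iff_integrableOn_Ioc_of_le hT]
    exact (integrable_const K₂).indicator hM'
  calc ‖∫ t in (0 : ℝ)..T, f t‖ ≤ ∫ t in (0 : ℝ)..T, (K₁ + M'.indicator (fun _ => K₂) t) := by
        refine intervalIntegral.norm_integral_le_of_norm_le hT
          (Eventually.of_forall fun t ht => ?_) (intervalIntegrable_const.add hint)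
        by_cases htM : t ∈ M'
        · rw [indicator_of_mem htM]
          linarith [h₂ t (Ioc_subset_Icc_self ht)]
        · rw [indicator_of_notMem htM, add_zero]
          exact h₁ t ⟨Ioc_subset_Icc_self ht, fun h => htM (subset_toMeasurable _ _ h)⟩
    _ = T * K₁ + (volume.restrict (Ioc 0 T)).real M' * K₂ := by
        rw [intervalIntegral.integral_add intervalIntegrable_const hint]
        congr 1
        · simp
        · rw [intervalIntegral.integral_of_le hT, integral_indicator_const _ hM', smul_eq_mul]
    _ ≤ T * K₁ + γ * K₂ := by
        gcongr
        refine ENNReal.toReal_le_of_le_ofReal hγ ((Measure.restrict_apply_le _ _).trans hvol)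

section Averaging

variable {k : ℕ} {T L C₀ : ℝ} {Ω : Set (Vec k)} {g : ℝ → Vec k → ℝ → Vec k} {v₀ : Vec k}

theorem continuousOn_field_comp
    (hg_cont : ContinuousOn (fun p : ℝ × Vec k × ℝ => g p.1 p.2.1 p.2.2)
      (univ ×ˢ Ω ×ˢ Icc (0 : ℝ) 1)) {ε : ℝ} (hε : ε ∈ Icc (0 : ℝ) 1) {u : ℝ → Vec k} {I : Set ℝ}
    (hu : ContinuousOn u I) (huΩ : ∀ t ∈ I, u t ∈ Ω) : ContinuousOn (fun t => g t (u t) ε) I :=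
  hg_cont.comp (f := fun t => (t, u t, ε))
    (continuousOn_id.prodMk (hu.prodMk continuousOn_const)) fun t ht => ⟨trivial, huΩ t ht, hε⟩

theorem intervalIntegrable_field_comp (hT : 0 ≤ T)
    (hg_cont : ContinuousOn (fun p : ℝ × Vec k × ℝ => g p.1 p.2.1 p.2.2)
      (univ ×ˢ Ω ×ˢ Icc (0 : ℝ) 1)) {ε : ℝ} (hε : ε ∈ Icc (0 : ℝ) 1) {u : ℝ → Vec k}
    (hu : ContinuousOn u (Icc 0 T)) (huΩ : ∀ t ∈ Icc 0 T, u t ∈ Ω) :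
    IntervalIntegrable (fun t => g t (u t) ε) volume 0 T :=
  ContinuousOn.intervalIntegrable_of_Icc hT (continuousOn_field_comp hg_cont hε hu huΩ)

theorem IsSolutionOn.sub_initial_eq (hT : 0 ≤ T)
    (hg_cont : ContinuousOn (fun p : ℝ × Vec k × ℝ => g p.1 p.2.1 p.2.2)
      (univ ×ˢ Ω ×ˢ Icc (0 : ℝ) 1)) {ε : ℝ} (hε : ε ∈ Icc (0 : ℝ) 1) {u : ℝ → Vec k}
    (hu : IsSolutionOn (fun t v => ε • g t v ε) Ω (Icc 0 T) u) :
    u T - u 0 = ε • ∫ t in (0 : ℝ)..T, g t (u t) ε := by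
  rw [← intervalIntegral.integral_smul]
  refine (intervalIntegral.integral_eq_sub_of_hasDerivAt_of_le hT hu.continuousOn
    (fun t ht => (hu t (Ioo_subset_Icc_self ht)).2.hasDerivAt (Icc_mem_nhds ht.1 ht.2)) ?_).symm
  exact (intervalIntegrable_field_comp hT hg_cont hε hu.continuousOn fun t ht => (hu t ht).1).smul ε

theorem scaled_lip (hlip : ∀ t, ∀ v₁ ∈ Ω, ∀ v₂ ∈ Ω, ∀ ε ∈ Icc (0 : ℝ) 1,
      ‖g t v₁ ε - g t v₂ ε‖ ≤ L * ‖v₁ - v₂‖) {ε : ℝ} (hε : ε ∈ Icc (0 : ℝ) 1) (t : ℝ) :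
    ∀ v₁ ∈ Ω, ∀ v₂ ∈ Ω, ‖ε • g t v₁ ε - ε • g t v₂ ε‖ ≤ ε * L * ‖v₁ - v₂‖ := by
  intro v₁ h₁ v₂ h₂
  rw [← smul_sub, norm_smul, Real.norm_of_nonneg hε.1, mul_assoc]
  exact mul_le_mul_of_nonneg_left (hlip t v₁ h₁ v₂ h₂ ε hε) hε.1

theorem scaled_norm_sub_le (hL : 0 ≤ L)
    (hlip : ∀ t, ∀ v₁ ∈ Ω, ∀ v₂ ∈ Ω, ∀ ε ∈ Icc (0 : ℝ) 1,
      ‖g t v₁ ε - g t v₂ ε‖ ≤ L * ‖v₁ - v₂‖) {ε : ℝ} (hε : ε ∈ Icc (0 : ℝ) 1)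
    {u₁ u₂ : ℝ → Vec k} (hu₁ : IsSolutionOn (fun t v => ε • g t v ε) Ω (Icc 0 T) u₁)
    (hu₂ : IsSolutionOn (fun t v => ε • g t v ε) Ω (Icc 0 T) u₂) {t : ℝ} (ht : t ∈ Icc 0 T) :
    ‖u₁ t - u₂ t‖ ≤ Real.exp (L * T) * ‖u₁ 0 - u₂ 0‖ := by
  have h := hu₁.norm_sub_le (scaled_lip hlip hε) hu₂ ht
  rw [mul_comm, sub_zero] at h
  refine h.trans ?_
  gcongr
  · exact ht.1
  · exact mul_le_of_le_one_left hL hε.2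
  · exact ht.2

theorem scaled_norm_sub_center_le (hL : 0 ≤ L) (hC₀ : 0 ≤ C₀)
    (hlip : ∀ t, ∀ v₁ ∈ Ω, ∀ v₂ ∈ Ω, ∀ ε ∈ Icc (0 : ℝ) 1,
      ‖g t v₁ ε - g t v₂ ε‖ ≤ L * ‖v₁ - v₂‖) (hv₀ : v₀ ∈ Ω)
    (hbound : ∀ t, ∀ ε ∈ Icc (0 : ℝ) 1, ‖g t v₀ ε‖ ≤ C₀) {ε : ℝ} (hε : ε ∈ Icc (0 : ℝ) 1)
    {u : ℝ → Vec k} (hu : IsSolutionOn (fun t v => ε • g t v ε) Ω (Icc 0 T) u) {t : ℝ}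
    (ht : t ∈ Icc 0 T) :
    ‖u t - v₀‖ ≤ (‖u 0 - v₀‖ + ε * (C₀ * T)) * Real.exp (L * T) := by
  have hε0 := hε.1
  have hT : 0 ≤ T := ht.1.trans ht.2
  have h := hu.norm_sub_const_le (mul_nonneg hε0 hL) (mul_nonneg hε0 hC₀) (scaled_lip hlip hε) hv₀
    (fun t => by
      rw [norm_smul, Real.norm_of_nonneg hε0]
      exact mul_le_mul_of_nonneg_left (hbound t ε hε) hε0) ht
  rw [sub_zero] at h
  refine h.trans ?_
  rw [← mul_assoc]
  gcongr
  · exact ht.2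
  · exact ht.1
  · exact mul_le_of_le_one_left hL hε.2
  · exact ht.2

/-- Variation of the difference of two solutions over one period. -/
theorem scaled_norm_sub_sub_le (hL : 0 ≤ L)
    (hlip : ∀ t, ∀ v₁ ∈ Ω, ∀ v₂ ∈ Ω, ∀ ε ∈ Icc (0 : ℝ) 1,
      ‖g t v₁ ε - g t v₂ ε‖ ≤ L * ‖v₁ - v₂‖) {ε : ℝ} (hε : ε ∈ Icc (0 : ℝ) 1)
    {u₁ u₂ : ℝ → Vec k} (hu₁ : IsSolutionOn (fun t v => ε • g t v ε) Ω (Icc 0 T) u₁)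
    (hu₂ : IsSolutionOn (fun t v => ε • g t v ε) Ω (Icc 0 T) u₂) {t : ℝ} (ht : t ∈ Icc 0 T) :
    ‖u₁ t - u₂ t - (u₁ 0 - u₂ 0)‖ ≤
      ε * (L * T * Real.exp (L * T)) * ‖u₁ 0 - u₂ 0‖ := by
  have hε0 := hε.1
  have h := (convex_Icc 0 T).norm_image_sub_le_of_norm_hasDerivWithin_le
    (f := fun t => u₁ t - u₂ t) (C := ε * L * (Real.exp (L * T) * ‖u₁ 0 - u₂ 0‖))
    (fun s hs => (hu₁ s hs).2.sub (hu₂ s hs).2)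
    (fun s hs => (scaled_lip hlip hε s _ (hu₁ s hs).1 _ (hu₂ s hs).1).trans
      (mul_le_mul_of_nonneg_left (scaled_norm_sub_le hL hlip hε hu₁ hu₂ hs)
        (mul_nonneg hε0 hL)))
    (left_mem_Icc.2 (ht.1.trans ht.2)) ht
  rw [sub_zero, Real.norm_of_nonneg ht.1] at h
  refine h.trans ?_
  calc _ ≤ ε * L * (Real.exp (L * T) * ‖u₁ 0 - u₂ 0‖) * T := by gcongr; exact ht.2
    _ = _ := by ring

/-- The time-`T` map of `ẋ = ε g(t, x, ε)` agrees with `1 + ε g₀'(v₀)` near `v₀` up to an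
`o(ε)`-Lipschitz error. -/
theorem exists_return_map_linearization (hT : 0 < T) (hΩ : IsOpen Ω)
    (hg_cont : ContinuousOn (fun p : ℝ × Vec k × ℝ => g p.1 p.2.1 p.2.2)
      (univ ×ˢ Ω ×ˢ Icc (0 : ℝ) 1)) (hL : 0 ≤ L) (hC₀ : 0 ≤ C₀)
    (hlip : ∀ t, ∀ v₁ ∈ Ω, ∀ v₂ ∈ Ω, ∀ ε ∈ Icc (0 : ℝ) 1,
      ‖g t v₁ ε - g t v₂ ε‖ ≤ L * ‖v₁ - v₂‖) (hv₀ : v₀ ∈ Ω)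
    (hbound : ∀ t, ∀ ε ∈ Icc (0 : ℝ) 1, ‖g t v₀ ε‖ ≤ C₀)
    (hg_diff : ∀ γ > 0, ∃ δ > 0, ∃ M ⊆ Icc (0 : ℝ) T,
      NullMeasurableSet M volume ∧ volume M < ENNReal.ofReal γ ∧
      ∀ v ∈ Metric.closedBall v₀ δ, ∀ t ∈ Icc (0 : ℝ) T \ M, ∀ ε ∈ Icc (0 : ℝ) δ,
        DifferentiableAt ℝ (fun w => g t w ε) v ∧
        ‖fderiv ℝ (fun w => g t w ε) v - fderiv ℝ (fun w => g t w 0) v₀‖ ≤ γ)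
    (hg₀_smooth : ContDiffAt ℝ 1 (averagingFunction T g) v₀) {η : ℝ} (hη : 0 < η) :
    ∃ δ > 0, ∃ ε₀ > 0, ε₀ ≤ 1 ∧ ∀ ε ∈ Ioc 0 ε₀, ∀ u₁ u₂ : ℝ → Vec k,
      IsSolutionOn (fun t v => ε • g t v ε) Ω (Icc 0 T) u₁ →
      IsSolutionOn (fun t v => ε • g t v ε) Ω (Icc 0 T) u₂ →
      u₁ 0 ∈ Metric.closedBall v₀ δ → u₂ 0 ∈ Metric.closedBall v₀ δ →
      ‖u₁ T - u₂ T - (u₁ 0 - u₂ 0 + ε • fderiv ℝ (averagingFunction T g) v₀ (u₁ 0 - u₂ 0))‖ ≤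
        ε * (η * ‖u₁ 0 - u₂ 0‖) := by
  set E := Real.exp (L * T) with hE
  have hE1 : 1 ≤ E := Real.one_le_exp (by positivity)
  have hE0 : 0 < E := by positivity
  set A := fderiv ℝ (averagingFunction T g) v₀ with hA
  -- The terms of the bracket collect the `γ`-errors: `T * E + T` from the mean value estimates off
  -- `M`, `L * E + L` from the Lipschitz bound on `M`, and `1` from strict differentiability of
  -- `g₀`. The other `η / 2` absorbs the drift of the solutions.
  obtain ⟨γ, hγ, hγη⟩ : ∃ γ > 0, γ * (T * E + T + L * E + L + 1) = η / 2 :=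
    ⟨η / 2 / (T * E + T + L * E + L + 1), by positivity, by field_simp⟩
  obtain ⟨δγ, hδγ, M, -, -, hM, hdiff⟩ := hg_diff γ hγ
  obtain ⟨s, hs, happrox⟩ := (hg₀_smooth.hasStrictFDerivAt one_ne_zero).approximates_deriv_on_nhds
    (c := γ.toNNReal) (Or.inr (Real.toNNReal_pos.2 hγ))
  obtain ⟨ρ₁, hρ₁, hρ₁s⟩ := Metric.nhds_basis_closedBall.mem_iff.1
    (inter_mem hs (hΩ.mem_nhds hv₀))
  set ρ := min ρ₁ δγ
  have hρ : 0 < ρ := lt_min hρ₁ hδγ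
  have hball : ∀ v ∈ Metric.closedBall v₀ ρ, v ∈ s ∧ v ∈ Ω ∧ v ∈ Metric.closedBall v₀ δγ :=
    fun v hv => ⟨(hρ₁s (Metric.closedBall_subset_closedBall (min_le_left _ _) hv)).1,
      (hρ₁s (Metric.closedBall_subset_closedBall (min_le_left _ _) hv)).2,
      Metric.closedBall_subset_closedBall (min_le_right _ _) hv⟩
  -- Gronwall multiplies the initial distance by `E`, using half of `ρ`; the bound on `ε` leaves the
  -- other half for the forcing term.
  refine ⟨ρ / (2 * E), by positivity,
    min (min 1 δγ) (min (ρ / (2 * (C₀ * T * E + 1))) (η / (2 * (T * (L * (L * T * E)) + 1)))),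
    by positivity, (min_le_left _ _).trans (min_le_left _ _), ?_⟩
  intro ε hε u₁ u₂ hu₁ hu₂ h10 h20
  have hε0 : 0 < ε := hε.1
  have hε1 : ε ≤ 1 := hε.2.trans ((min_le_left _ _).trans (min_le_left _ _))
  have hεγ : ε ≤ δγ := hε.2.trans ((min_le_left _ _).trans (min_le_right _ _))
  have hερ : ε * (C₀ * T) * E ≤ ρ / 2 := by
    have h1 : ε ≤ ρ / (2 * (C₀ * T * E + 1)) :=
      hε.2.trans ((min_le_right _ _).trans (min_le_left _ _))
    rw [le_div_iff₀ (by positivity)] at h1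
    linarith
  have hεη : ε * (T * (L * (L * T * E))) ≤ η / 2 := by
    have h1 : ε ≤ η / (2 * (T * (L * (L * T * E)) + 1)) :=
      hε.2.trans ((min_le_right _ _).trans (min_le_right _ _))
    rw [le_div_iff₀ (by positivity)] at h1
    linarith
  have hεI : ε ∈ Icc (0 : ℝ) 1 := ⟨hε0.le, hε1⟩
  have h0I : (0 : ℝ) ∈ Icc (0 : ℝ) 1 := ⟨le_rfl, zero_le_one⟩
  have hstay : ∀ u : ℝ → Vec k, IsSolutionOn (fun t v => ε • g t v ε) Ω (Icc 0 T) u →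
      u 0 ∈ Metric.closedBall v₀ (ρ / (2 * E)) → ∀ t ∈ Icc 0 T,
      u t ∈ Metric.closedBall v₀ ρ := by
    intro u hu hu0 t ht
    rw [mem_closedBall_iff_norm] at hu0 ⊢
    have h1 := scaled_norm_sub_center_le hL hC₀ hlip hv₀ hbound hεI hu ht
    rw [le_div_iff₀ (by positivity)] at hu0
    rw [← hE] at h1
    linarith
  have h1ρ := hstay u₁ hu₁ h10 0 (left_mem_Icc.2 hT.le)
  have h2ρ := hstay u₂ hu₂ h20 0 (left_mem_Icc.2 hT.le)
  set v₁ := u₁ 0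
  set v₂ := u₂ 0
  set d := ‖v₁ - v₂‖
  have hd : 0 ≤ d := norm_nonneg _
  have hint₁ := intervalIntegrable_field_comp hT.le hg_cont hεI hu₁.continuousOn
    fun t ht => (hu₁ t ht).1
  have hint₂ := intervalIntegrable_field_comp hT.le hg_cont hεI hu₂.continuousOn
    fun t ht => (hu₂ t ht).1
  have hint₃ := intervalIntegrable_field_comp hT.le hg_cont h0I
    (continuousOn_const (c := v₁)) fun t ht => (hball _ h1ρ).2.1
  have hint₄ := intervalIntegrable_field_comp hT.le hg_cont h0I
    (continuousOn_const (c := v₂)) fun t ht => (hball _ h2ρ).2.1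
  -- The true increment is compared with that of the averaged field at the frozen points `v₁`, `v₂`.
  set h : ℝ → Vec k := fun t => (g t (u₁ t) ε - g t (u₂ t) ε) - (g t v₁ 0 - g t v₂ 0) with hh
  have hint : ∫ t in (0 : ℝ)..T, h t = ((∫ t in (0 : ℝ)..T, g t (u₁ t) ε) -
      ∫ t in (0 : ℝ)..T, g t (u₂ t) ε) - (averagingFunction T g v₁ - averagingFunction T g v₂) := by
    rw [hh, intervalIntegral.integral_sub (hint₁.sub hint₂) (hint₃.sub hint₄),
      intervalIntegral.integral_sub hint₁ hint₂, intervalIntegral.integral_sub hint₃ hint₄]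
    rfl
  have hgood : ∀ t ∈ Icc 0 T \ M, ‖h t‖ ≤ (γ * E + γ + ε * (L * (L * T * E))) * d := by
    intro t ht
    -- `D` serves both increments and cancels pointwise in `t`, so it is never integrated in `t` or
    -- related to `A`.
    set D := fderiv ℝ (fun w => g t w 0) v₀
    have hD : ‖D‖ ≤ L := by
      refine norm_fderiv_le_of_lip' ℝ hL ?_
      filter_upwards [hΩ.mem_nhds hv₀] with w hw using hlip t w hw v₀ hv₀ 0 h0I
    have hmv : ∀ e ∈ Icc 0 δγ, ∀ a ∈ Metric.closedBall v₀ ρ, ∀ b ∈ Metric.closedBall v₀ ρ,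
        ‖g t a e - g t b e - D (a - b)‖ ≤ γ * ‖a - b‖ := fun e he a ha b hb =>
      (convex_closedBall v₀ ρ).norm_image_sub_le_of_norm_fderiv_le'
        (fun v hv => (hdiff v (hball v hv).2.2 t ht e he).1)
        (fun v hv => (hdiff v (hball v hv).2.2 t ht e he).2) hb ha
    have p1 := hmv ε ⟨hε0.le, hεγ⟩ _ (hstay u₁ hu₁ h10 t ht.1) _ (hstay u₂ hu₂ h20 t ht.1)
    have p2 := hmv 0 ⟨le_rfl, hδγ.le⟩ _ h1ρ _ h2ρ
    have p3 : ‖D (u₁ t - u₂ t - (v₁ - v₂))‖ ≤ L * (ε * (L * T * E) * d) :=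
      (D.le_opNorm _).trans (mul_le_mul hD (scaled_norm_sub_sub_le hL hlip hεI hu₁ hu₂ ht.1)
        (norm_nonneg _) hL)
    have p4 : γ * ‖u₁ t - u₂ t‖ ≤ γ * (E * d) :=
      mul_le_mul_of_nonneg_left (scaled_norm_sub_le hL hlip hεI hu₁ hu₂ ht.1) hγ.le
    have hsplit : h t = (g t (u₁ t) ε - g t (u₂ t) ε - D (u₁ t - u₂ t)) -
        (g t v₁ 0 - g t v₂ 0 - D (v₁ - v₂)) + D (u₁ t - u₂ t - (v₁ - v₂)) := by
      simp only [hh, map_sub]; abel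
    rw [hsplit]
    refine (norm_add_le _ _).trans ((add_le_add_left (norm_sub_le _ _) _).trans ?_)
    linarith
  have hbad : ∀ t ∈ Icc 0 T, ‖h t‖ ≤ (L * E + L) * d := by
    intro t ht
    have p1 := hlip t _ (hu₁ t ht).1 _ (hu₂ t ht).1 ε hεI
    have p2 := hlip t _ (hball _ h1ρ).2.1 _ (hball _ h2ρ).2.1 0 h0I
    have p3 := mul_le_mul_of_nonneg_left (scaled_norm_sub_le hL hlip hεI hu₁ hu₂ ht) hL
    refine (norm_sub_le _ _).trans ?_
    linarith
  have hI := norm_intervalIntegral_le_of_small_set hT.le (by positivity) (by positivity) hγ.le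
    hM.le hgood hbad
  have hS : ‖averagingFunction T g v₁ - averagingFunction T g v₂ - A (v₁ - v₂)‖ ≤ γ * d := by
    have := happrox v₁ (hball _ h1ρ).1 v₂ (hball _ h2ρ).1
    rwa [Real.coe_toNNReal _ hγ.le] at this
  have hfinal : u₁ T - u₂ T - (v₁ - v₂ + ε • A (v₁ - v₂)) = ε • ((∫ t in (0 : ℝ)..T, h t) +
      (averagingFunction T g v₁ - averagingFunction T g v₂ - A (v₁ - v₂))) := by
    have e1 := hu₁.sub_initial_eq hT.le hg_cont hεI
    have e2 := hu₂.sub_initial_eq hT.le hg_cont hεI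
    rw [sub_eq_iff_eq_add] at e1 e2
    rw [hint, e1, e2]
    module
  rw [hfinal, norm_smul, Real.norm_of_nonneg hε0.le]
  refine mul_le_mul_of_nonneg_left ((norm_add_le _ _).trans ((add_le_add hI hS).trans ?_)) hε0.le
  have hγd : γ * (T * E + T + L * E + L + 1) * d = η / 2 * d := by rw [hγη]
  have hεd : ε * (T * (L * (L * T * E))) * d ≤ η / 2 * d := mul_le_mul_of_nonneg_right hεη hd
  linarith

/-- The solution stays within `O(ε)` of `v₀`, and `g(t, v₀, ·)` is continuous at `0` uniformly in
`t` by compactness. The integrand is thus uniformly close to `g(t, v₀, 0)`, whose integral vanishes.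
-/
theorem exists_return_map_displacement_le (hT : 0 < T)
    (hg_cont : ContinuousOn (fun p : ℝ × Vec k × ℝ => g p.1 p.2.1 p.2.2)
      (univ ×ˢ Ω ×ˢ Icc (0 : ℝ) 1)) (hL : 0 ≤ L) (hC₀ : 0 ≤ C₀)
    (hlip : ∀ t, ∀ v₁ ∈ Ω, ∀ v₂ ∈ Ω, ∀ ε ∈ Icc (0 : ℝ) 1,
      ‖g t v₁ ε - g t v₂ ε‖ ≤ L * ‖v₁ - v₂‖) (hv₀ : v₀ ∈ Ω)
    (hbound : ∀ t, ∀ ε ∈ Icc (0 : ℝ) 1, ‖g t v₀ ε‖ ≤ C₀)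
    (hzero : averagingFunction T g v₀ = 0) {η : ℝ} (hη : 0 < η) :
    ∃ ε₀ > 0, ε₀ ≤ 1 ∧ ∀ ε ∈ Ioc 0 ε₀, ∀ u : ℝ → Vec k,
      IsSolutionOn (fun t v => ε • g t v ε) Ω (Icc 0 T) u → u 0 = v₀ →
      ‖u T - v₀‖ ≤ ε * η := by
  set E := Real.exp (L * T) with hE
  have hE0 : 0 < E := Real.exp_pos _
  have hunif : UniformContinuousOn (fun p : ℝ × ℝ => g p.1 v₀ p.2) (Icc 0 T ×ˢ Icc 0 1) :=
    (isCompact_Icc.prod isCompact_Icc).uniformContinuousOn_of_continuous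
      (hg_cont.comp (f := fun p : ℝ × ℝ => (p.1, v₀, p.2)) (by fun_prop)
        fun p hp => ⟨trivial, hv₀, hp.2⟩)
  obtain ⟨δ, hδ, hunif⟩ := Metric.uniformContinuousOn_iff.1 hunif (η / (2 * T)) (by positivity)
  refine ⟨min (min 1 (δ / 2)) (η / (2 * T * (L * (C₀ * T * E) + 1))), by positivity,
    (min_le_left _ _).trans (min_le_left _ _), ?_⟩
  intro ε hε u hu hu0
  have hε0 : 0 < ε := hε.1
  have hε1 : ε ≤ 1 := hε.2.trans ((min_le_left _ _).trans (min_le_left _ _))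
  have hεδ : ε ≤ δ / 2 := hε.2.trans ((min_le_left _ _).trans (min_le_right _ _))
  have hεη : ε * (L * (C₀ * T * E)) ≤ η / (2 * T) := by
    have h1 : ε ≤ η / (2 * T * (L * (C₀ * T * E) + 1)) := hε.2.trans (min_le_right _ _)
    rw [le_div_iff₀ (by positivity)] at h1 ⊢
    nlinarith [mul_pos hε0 hT]
  have hεI : ε ∈ Icc (0 : ℝ) 1 := ⟨hε0.le, hε1⟩
  have h0I : (0 : ℝ) ∈ Icc (0 : ℝ) 1 := ⟨le_rfl, zero_le_one⟩
  have hint₁ := intervalIntegrable_field_comp hT.le hg_cont hεI hu.continuousOn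
    fun t ht => (hu t ht).1
  have hint₂ := intervalIntegrable_field_comp hT.le hg_cont h0I
    (continuousOn_const (c := v₀)) fun t ht => hv₀
  have hz : ∫ t in (0 : ℝ)..T, g t v₀ 0 = 0 := hzero
  have e1 := hu.sub_initial_eq hT.le hg_cont hεI
  rw [← sub_zero (∫ t in (0 : ℝ)..T, g t (u t) ε), ← hz,
    ← intervalIntegral.integral_sub hint₁ hint₂, hu0] at e1
  rw [e1, norm_smul, Real.norm_of_nonneg hε0.le]
  refine mul_le_mul_of_nonneg_left ?_ hε0.le
  have hI := intervalIntegral.norm_integral_le_of_norm_le_const (a := 0) (b := T) (C := η / T)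
    (f := fun t => g t (u t) ε - g t v₀ 0) fun t ht => by
      rw [uIoc_of_le hT.le] at ht
      have ht' := Ioc_subset_Icc_self ht
      have p1 := hlip t _ (hu t ht').1 v₀ hv₀ ε hεI
      have p2 := scaled_norm_sub_center_le hL hC₀ hlip hv₀ hbound hεI hu ht'
      rw [hu0, sub_self, norm_zero, zero_add, ← hE] at p2
      have p3 := mul_le_mul_of_nonneg_left p2 hL
      have p4 := hunif (t, ε) ⟨ht', hεI⟩ (t, 0) ⟨ht', h0I⟩ (by
        rw [Prod.dist_eq, dist_self, Real.dist_eq, sub_zero, abs_of_pos hε0]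
        exact max_lt hδ (by linarith))
      rw [dist_eq_norm] at p4
      have p5 := norm_add_le (g t (u t) ε - g t v₀ ε) (g t v₀ ε - g t v₀ 0)
      rw [sub_add_sub_cancel] at p5
      have p6 : η / T = η / (2 * T) + η / (2 * T) := by field_simp; ring
      rw [p6]
      linarith
  rwa [sub_zero, abs_of_pos hT, div_mul_cancel₀ _ hT.ne'] at hI

end Averaging

/-! ### Convergence to `v₀` and the main theorem. -/

/-- The a posteriori estimate for contractions: the triangle inequality through `P v₀` bounds the
distance from `v₀` to the fixed point by the displacement of `v₀`. -/
theorem HasContractingReturnMap.one_sub_mul_q_le {k : ℕ} {f : ℝ → Vec k → Vec k} {Ω : Set (Vec k)}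
    {v₀ : Vec k} {T δ R K B κ c C : ℝ} {q : Seminorm ℝ (Vec k)}
    (H : HasContractingReturnMap f Ω v₀ T δ R K B κ c C q) {x : ℝ → Vec k}
    (hx : IsPeriodicSolution f Ω T x) (hx0 : x 0 ∈ Metric.closedBall v₀ δ) {b : ℝ}
    (hret : ∀ u, IsSolutionOn f Ω (Icc 0 T) u → u 0 = v₀ → q (u T - v₀) ≤ b) :
    (1 - κ) * q (x 0 - v₀) ≤ b := by
  obtain ⟨u, hu, hu0⟩ := H.exists_truncated_solution 0 v₀
  have hself : v₀ ∈ Metric.closedBall v₀ δ := Metric.mem_closedBall_self H.δ_pos.le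
  have hu' : IsSolutionOn f Ω (Icc 0 T) u := H.isSolutionOn_of_truncated hu fun t ht =>
    H.truncated_stays hu (by rwa [hu0]) ht.1 (by linarith [ht.2])
  have h1 := H.contract x u (hx.1.mono (subset_univ _)) hu' hx0 (by rwa [hu0])
  have h2 := hret u hu' hu0
  have h3 := map_add_le_add q (x T - u T) (u T - v₀)
  have h4 := hx.2 0
  rw [zero_add] at h4
  rw [sub_add_sub_cancel, h4] at h3
  rw [h4, hu0] at h1
  linarith

theorem mainTheorem2 (k : ℕ) (T : ℝ) (hT : 0 < T)
    (Ω : Set (Vec k)) (hΩ : IsOpen Ω)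
    (g : ℝ → Vec k → ℝ → Vec k)
    (hg_cont : ContinuousOn (fun p : ℝ × Vec k × ℝ => g p.1 p.2.1 p.2.2)
      (univ ×ˢ Ω ×ˢ Icc (0 : ℝ) 1))
    (hg_per : ∀ t : ℝ, ∀ v ∈ Ω, ∀ ε ∈ Icc (0 : ℝ) 1, g (t + T) v ε = g t v ε)
    (hg_lip : ∃ L > 0, ∀ t ∈ Icc 0 T, ∀ v₁ ∈ Ω, ∀ v₂ ∈ Ω, ∀ ε ∈ Icc (0 : ℝ) 1,
      ‖g t v₁ ε - g t v₂ ε‖ ≤ L * ‖v₁ - v₂‖)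
    (v₀ : Vec k) (hv₀ : v₀ ∈ Ω)
    (hzero : averagingFunction T g v₀ = 0)
    (hg_diff : ∀ γ > 0, ∃ δ > 0, ∃ M ⊆ Icc (0 : ℝ) T,
      NullMeasurableSet M volume ∧ volume M < ENNReal.ofReal γ ∧
      ∀ v ∈ Metric.closedBall v₀ δ, ∀ t ∈ Icc (0 : ℝ) T \ M, ∀ ε ∈ Icc (0 : ℝ) δ,
        DifferentiableAt ℝ (fun w => g t w ε) v ∧
        ‖fderiv ℝ (fun w => g t w ε) v - fderiv ℝ (fun w => g t w 0) v₀‖ ≤ γ)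
    (hg₀_smooth : ContDiffAt ℝ 1 (averagingFunction T g) v₀)
    (hg₀_eig : EigenvaluesNegRealPart (jacobianMatrix (averagingFunction T g) v₀)) :
    ∃ δ₁ > 0, ∃ ε₁ > 0, ε₁ ≤ 1 ∧ ε₁ ≤ δ₁ ∧
      ∃ x : ℝ → ℝ → Vec k,
        (∀ ε ∈ Ioc 0 ε₁,
          IsPeriodicSolution (fun t v => ε • g t v ε) Ω T (x ε) ∧
          x ε 0 ∈ Metric.closedBall v₀ δ₁ ∧
          (∀ y : ℝ → Vec k, IsPeriodicSolution (fun t v => ε • g t v ε) Ω T y →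
            y 0 ∈ Metric.closedBall v₀ δ₁ → y = x ε) ∧
          IsAsymptoticallyStable (fun t v => ε • g t v ε) Ω (x ε)) ∧
        Tendsto (fun ε => x ε 0) (𝓝[>] 0) (𝓝 v₀) := by
  obtain ⟨L, hL, hlip₀⟩ := hg_lip
  have hlip : ∀ t, ∀ v₁ ∈ Ω, ∀ v₂ ∈ Ω, ∀ ε ∈ Icc (0 : ℝ) 1,
      ‖g t v₁ ε - g t v₂ ε‖ ≤ L * ‖v₁ - v₂‖ := by
    intro t v₁ h₁ v₂ h₂ ε hε
    have hper : Function.Periodic (fun t => g t v₁ ε - g t v₂ ε) T := fun t => by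
      simp only [hg_per t v₁ h₁ ε hε, hg_per t v₂ h₂ ε hε]
    obtain ⟨s, hs, hst⟩ := hper.exists_mem_Ico₀ hT t
    rw [hst]
    exact hlip₀ s (Ico_subset_Icc_self hs) v₁ h₁ v₂ h₂ ε hε
  obtain ⟨C₀, hC₀, hbound⟩ : ∃ C₀ : ℝ, 0 ≤ C₀ ∧ ∀ t, ∀ ε ∈ Icc (0 : ℝ) 1, ‖g t v₀ ε‖ ≤ C₀ := by
    have hcomp : ContinuousOn (fun p : ℝ × ℝ => g p.1 v₀ p.2) (Icc 0 T ×ˢ Icc 0 1) :=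
      hg_cont.comp (f := fun p : ℝ × ℝ => (p.1, v₀, p.2)) (by fun_prop)
        fun p hp => ⟨trivial, hv₀, hp.2⟩
    obtain ⟨C₀, hC₀⟩ := (isCompact_Icc.prod isCompact_Icc).exists_bound_of_continuousOn hcomp
    refine ⟨max C₀ 0, le_max_right _ _, fun t ε hε => ?_⟩
    have hper : Function.Periodic (fun t => g t v₀ ε) T := fun t => hg_per t v₀ hv₀ ε hε
    obtain ⟨s, hs, hst⟩ := hper.exists_mem_Ico₀ hT t
    rw [hst]
    exact (hC₀ (s, ε) ⟨Ico_subset_Icc_self hs, hε⟩).trans (le_max_left _ _)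
  obtain ⟨q, c, hc, C, hC, α, hα, h, hh, hcq, hqC, hqA⟩ :=
    exists_lyapunov_seminorm (fderiv ℝ (averagingFunction T g) v₀) hg₀_eig
  -- With this `η`, norm equivalence bounds the linearization error by `α * ε / 2 * q w`, half of
  -- the contraction gained from `A`.
  obtain ⟨δ, hδ, εa, hεa, hεa1, hlin⟩ := exists_return_map_linearization hT hΩ hg_cont hL.le hC₀
    hlip hv₀ hbound hg_diff hg₀_smooth (η := α * c / (2 * C)) (by positivity)
  obtain ⟨R, hR, hRΩ⟩ := Metric.nhds_basis_closedBall.mem_iff.1 (hΩ.mem_nhds hv₀)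
  set δ₁ := min δ (R / 2)
  have hδ₁ : 0 < δ₁ := by positivity
  -- The `q`-ball of radius `r` lies in the ball of radius `δ₁ / 2`; the stability argument needs
  -- the fixed point strictly inside the `δ₁`-ball.
  obtain ⟨r, hr⟩ : ∃ r, r = c * (δ₁ / 2) := ⟨_, rfl⟩
  have hr0 : 0 < r := by rw [hr]; positivity
  have hqball : ∀ v, q (v - v₀) ≤ r → ‖v - v₀‖ ≤ δ₁ / 2 := fun v hv => by
    rw [hr] at hv
    exact le_of_mul_le_mul_left ((hcq _).trans hv) hc
  -- The factor `α * ε / 2` is exactly `1 - κ`, so it cancels against the contraction gap and leaves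
  -- a bound `b` free of `ε`.
  have hdisp : ∀ b > 0, ∃ ε₀ > 0, ε₀ ≤ 1 ∧ ∀ ε ∈ Ioc 0 ε₀, ∀ u : ℝ → Vec k,
      IsSolutionOn (fun t v => ε • g t v ε) Ω (Icc 0 T) u → u 0 = v₀ →
      q (u T - v₀) ≤ α * ε / 2 * b := by
    intro b hb
    obtain ⟨ε₀, hε₀, hε₀1, hu⟩ := exists_return_map_displacement_le hT hg_cont hL.le hC₀ hlip hv₀
      hbound hzero (η := α * b / (2 * C)) (by positivity)
    refine ⟨ε₀, hε₀, hε₀1, fun ε hε u hsol hu0 => ?_⟩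
    calc q (u T - v₀) ≤ C * ‖u T - v₀‖ := hqC _
      _ ≤ C * (ε * (α * b / (2 * C))) := by gcongr; exact hu ε hε u hsol hu0
      _ = _ := by field_simp
  obtain ⟨εb, hεb, -, hret⟩ := hdisp r hr0
  -- The entry `h` is the range of the Lyapunov estimate, `1 / α` keeps `κ` nonnegative, and the
  -- quotient by `(C₀ + L * R) * T` keeps the motion over a period below `R / 2`.
  set ε₁ := min (min εa εb) (min (min h (1 / α)) (min (R / (2 * ((C₀ + L * R) * T + 1))) δ₁))
  have hε₁ : 0 < ε₁ := by positivity
  have hH : ∀ ε ∈ Ioc 0 ε₁, HasContractingReturnMap (fun t v => ε • g t v ε) Ω v₀ T δ₁ R (ε * L)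
      (ε * (C₀ + L * R)) (1 - α * ε / 2) c C q := by
    intro ε hε
    have hε0 : 0 < ε := hε.1
    have h1 : ε ≤ εa := hε.2.trans ((min_le_left _ _).trans (min_le_left _ _))
    have h2 : ε ≤ h :=
      hε.2.trans ((min_le_right _ _).trans ((min_le_left _ _).trans (min_le_left _ _)))
    have h3 : ε ≤ 1 / α :=
      hε.2.trans ((min_le_right _ _).trans ((min_le_left _ _).trans (min_le_right _ _)))
    have h4 : ε ≤ R / (2 * ((C₀ + L * R) * T + 1)) :=
      hε.2.trans ((min_le_right _ _).trans ((min_le_right _ _).trans (min_le_left _ _)))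
    have hεI : ε ∈ Icc (0 : ℝ) 1 := ⟨hε0.le, h1.trans hεa1⟩
    rw [le_div_iff₀ (by positivity)] at h3 h4
    have hαε : 0 < α * ε := by positivity
    have hδR : δ₁ ≤ R / 2 := min_le_right _ _
    refine ⟨hT, hδ₁, hR, by positivity, by linarith, hRΩ, fun t v hv => ?_, fun v hv => ?_,
      scaled_lip hlip hεI, fun t v hv => ?_, by linarith, by linarith, hc, hcq, hqC, hC, ?_⟩
    · simp only [hg_per t v hv ε hεI]
    · exact (continuousOn_univ.1 (continuousOn_field_comp hg_cont hεI
        (continuousOn_const (c := v)) fun _ _ => hv)).const_smul ε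
    · rw [norm_smul, Real.norm_of_nonneg hε0.le]
      refine mul_le_mul_of_nonneg_left ?_ hε0.le
      have p1 := norm_add_le (g t v ε - g t v₀ ε) (g t v₀ ε)
      rw [sub_add_cancel] at p1
      have p2 := hlip t v (hRΩ hv) v₀ hv₀ ε hεI
      have p3 := mul_le_mul_of_nonneg_left (mem_closedBall_iff_norm.1 hv) hL.le
      linarith [hbound t ε hεI]
    · intro u v hu hv hu0 hv0
      have hsub := Metric.closedBall_subset_closedBall (x := v₀) (min_le_left δ (R / 2))
      have p1 := hlin ε ⟨hε0, h1⟩ u v hu hv (hsub hu0) (hsub hv0)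
      set w := u 0 - v 0
      set A := fderiv ℝ (averagingFunction T g) v₀
      have p2 := map_add_le_add q (u T - v T - (w + ε • A w)) (w + ε • A w)
      rw [sub_add_cancel] at p2
      have p3 : q (u T - v T - (w + ε • A w)) ≤ α * ε / 2 * q w := by
        calc _ ≤ C * (ε * (α * c / (2 * C) * ‖w‖)) := (hqC _).trans (by gcongr)
          _ = α * ε / 2 * (c * ‖w‖) := by field_simp
          _ ≤ _ := by gcongr; exact hcq w
      linarith [hqA ε ⟨hε0.le, h2⟩ w]
  have hexists : ∀ ε ∈ Ioc 0 ε₁, ∃ x, IsPeriodicSolution (fun t v => ε • g t v ε) Ω T x ∧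
      x 0 ∈ Metric.closedBall v₀ δ₁ ∧ IsAsymptoticallyStable (fun t v => ε • g t v ε) Ω x := by
    intro ε hε
    have hεb' : ε ≤ εb := hε.2.trans ((min_le_left _ _).trans (min_le_right _ _))
    have H := hH ε hε
    obtain ⟨x, hx, hper, hx0⟩ := H.exists_periodic_truncated hr0.le
      (fun v hv => mem_closedBall_iff_norm.2 ((hqball v hv).trans (by linarith)))
      (fun u hu hu0 => (hret ε ⟨hε.1, hεb'⟩ u hu hu0).trans_eq (by ring))
    have hxball : x 0 ∈ Metric.ball v₀ δ₁ :=
      mem_ball_iff_norm.2 ((hqball _ hx0).trans_lt (by linarith))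
    have hxball' := Metric.ball_subset_closedBall hxball
    exact ⟨x, ⟨H.isSolutionOn_of_truncated hx fun t _ => H.periodic_truncated_mem hx hper hxball' t,
      hper⟩, hxball', H.isAsymptoticallyStable hx hper hxball⟩
  choose! x hxper hxball hxstab using hexists
  refine ⟨δ₁, hδ₁, ε₁, hε₁, (min_le_left _ _).trans ((min_le_left _ _).trans hεa1),
    (min_le_right _ _).trans ((min_le_right _ _).trans (min_le_right _ _)), x, fun ε hε =>
    ⟨hxper ε hε, hxball ε hε, fun y hy hy0 =>
      (hH ε hε).periodic_unique (hxper ε hε) hy (hxball ε hε) hy0, hxstab ε hε⟩, ?_⟩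
  rw [Metric.tendsto_nhds]
  intro ζ hζ
  -- This choice of `b` yields `‖x ε 0 - v₀‖ ≤ ζ / 2` after division by `1 - κ` and `c`.
  obtain ⟨εc, hεc, -, hsmall⟩ := hdisp (c * (ζ / 2)) (by positivity)
  filter_upwards [Ioc_mem_nhdsGT (lt_min hε₁ hεc)] with ε hε
  have hε0 : 0 < ε := hε.1
  have hε' : ε ∈ Ioc 0 ε₁ := ⟨hε0, hε.2.trans (min_le_left _ _)⟩
  have p1 := (hH ε hε').one_sub_mul_q_le (hxper ε hε') (hxball ε hε')
    (hsmall ε ⟨hε0, hε.2.trans (min_le_right _ _)⟩)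
  rw [sub_sub_cancel] at p1
  have p2 := le_of_mul_le_mul_left p1 (by positivity)
  have p3 := le_of_mul_le_mul_left ((hcq _).trans p2) hc
  rw [dist_eq_norm]
  linarith

end
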